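/- Let $G=(V,E,w)$ be an undirected weighted graph with positive edge weights, $n$ nodes, $m$ edges and no isolated node. Let $d_v=\sum_u w(v,u)$, $\operatorname{vol}(S)=\sum_{v\in S}d_v$, $\phi(S)=w(S,V\setminus S)/\operatorname{vol}(S)$, let $\rho(k)$ be the minimum of $\max_i\phi(A_i)$ over all partitions of $V$ into $k$ nonempty sets $A_1,\dots,A_k$, let $\lambda_1\le\dots\le\lambda_n$ be the eigenvalues of the normalised Laplacian $\mathcal L=I-D^{-1/2}AD^{-1/2}$, and let $\Upsilon_G(k)=\lambda_{k+1}/\rho(k)$ for $k<n$ (equal to $\infty$ if $\rho(k)=0<\lambda_{k+1}$). Consider distributed algorithms of the following form, with parameters $\bar s=\bar s(n,k,\beta)\ge 0$, $T\in\mathbb N$ and a threshold function $\theta$. The nodes have distinct, linearly ordered identifiers. (1) Seeding: each node $v$ independently becomes active with probability $\min\{1,\bar s\,d_v/\operatorname{vol}(V)\}$; each active node $i$ starts a vector $x^{(0,i)}$ that has entry $1/\sqrt{d_i}$ at $i$ and $0$ elsewhere. (2) Averaging: for $T$ rounds, $x^{(t,i)}=(I-\tfrac12\mathcal L)\,x^{(t-1,i)}$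 for all active $i$. In each round every node $u$ sends to each neighbour, for every active $i$ with $x^{(t-1,i)}(u)\ne0$, two words: $i$ and $x^{(t-1,i)}(u)/\sqrt{d_u}$. (3) Query: each node $v$ takes as its label $\ell_v$ the least active $i$ with $x^{(T,i)}(v)\neq 0$ and $x^{(T,i)}(v)\ge\theta$, where the threshold $\theta$ is computed locally from $n,k,\beta,\operatorname{vol}(V),d_v$ and the nonzero values $x^{(T,j)}(v)$ held by $v$; $v$ gets no label if there is no such $i$. Theorem. There are choices of $\bar s(n,k,\beta)$ and of $\theta$, and constants $c_1,M>0$, such that for all $c_2\in\mathbb{R}$ and $\varepsilon>0$ there are $C>0$ and $N$ for which the following holds. Let $G$ be as above with $n\ge N$ nodes, let $k<n$, let $S_1,\dots,S_k$ be an optimal $k$-way partition (one that attains $\rho(k)$), let $0<\beta\le\frac12$ (the bound $\frac12$ is automatic if $k\ge2$) with $\operatorname{vol}(S_i)\ge\beta\operatorname{vol}(V)$ for all $i$, and assume $$\Upsilon_G(k)\ \ge\ C\left(k^4\log^2\tfrac1\beta+\log n\right).$$ Then for every integer $T$ with $c_1\frac{\log n}{\lambda_{k+1}}\le T\le c_2\frac{\log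 n}{\lambda_{k+1}}$, with probability greater than $0.99$ both of the following hold: (i) there is an injective assignment $\sigma$ of labels to the clusters with $$\operatorname{vol}\Big(\bigcup_{i=1}^k\{v\in S_i:\ell_v\ne\sigma(i)\}\Big)\le\varepsilon\operatorname{vol}(V);$$ (ii) the total number of words sent in the $T$ rounds is at most $M\cdot T\cdot m\cdot\frac1\beta\log\frac1\beta$. In other words, if $\Upsilon_G(k)=\omega(k^4\log^2\frac1\beta+\log n)$ as $n\to\infty$, then the algorithm finishes in $T=\Theta(\log n/\lambda_{k+1})$ rounds and, with probability greater than $0.99$, misclassifies total volume $o(\operatorname{vol}(V))$ with message complexity $O(T\cdot m\cdot\frac1\beta\log\frac1\beta)$. -/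

import Mathlib

open scoped NNReal ENNReal

noncomputable section

/-- A finite undirected weighted graph: two distinct nodes `u`, `v` are joined by an edge
exactly when the weight `w u v` is positive. -/
structure WeightedGraph (V : Type*) where
  w : V → V → ℝ
  symm : ∀ u v, w u v = w v u
  nonneg : ∀ u v, 0 ≤ w u v
  loopless : ∀ v, w v v = 0

namespace WeightedGraph

variable {V : Type*} (G : WeightedGraph V)

/-- The underlying simple graph. -/
def graph : SimpleGraph V where
  Adj u v := 0 < G.w u v
  symm := ⟨fun u v h => by rw [G.symm v u]; exact h⟩
  loopless := ⟨fun v h => by rw [G.loopless v] at h; exact lt_irrefl _ h⟩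

/-- The number `m` of edges. -/
def numEdges : ℕ := G.graph.edgeSet.ncard

variable [Fintype V]

/-- The weighted degree `d_v`. -/
def deg (v : V) : ℝ := ∑ u, G.w v u

/-- The volume of a set of nodes. -/
def vol (S : Finset V) : ℝ := ∑ v ∈ S, G.deg v

/-- `vol(V)`. -/
def totalVol : ℝ := G.vol Finset.univ

variable [DecidableEq V]

/-- The conductance `φ(S) = w(S, V \ S) / vol(S)`. -/
def conductance (S : Finset V) : ℝ := (∑ u ∈ S, ∑ v ∈ Sᶜ, G.w u v) / G.vol S

/-! A `k`-way partition of `V` into nonempty clusters `S_0, …, S_{k-1}` is given by a surjective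
map `S : V → Fin k`, which sends a node to the index of its cluster. -/

/-- The `i`-th cluster. -/
def cluster {k : ℕ} (S : V → Fin k) (i : Fin k) : Finset V := Finset.univ.filter (fun v => S v = i)

/-- The largest conductance of a cluster of the partition. -/
def maxConductance {k : ℕ} (S : V → Fin k) : ℝ := ⨆ i, G.conductance (cluster S i)

/-- The `k`-way expansion constant `ρ(k)`: a minimum over all `k`-way partitions. -/
def rho (k : ℕ) : ℝ := ⨅ S : {S : V → Fin k // Function.Surjective S}, G.maxConductance S.1

/-- `S` is an optimal `k`-way partition, that is, one that attains `ρ(k)`. -/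
def IsOptimalClustering {k : ℕ} (S : V → Fin k) : Prop :=
  Function.Surjective S ∧ G.maxConductance S = G.rho k

/-- The normalised Laplacian `I - D^{-1/2} A D^{-1/2}`. -/
def laplacian : Matrix V V ℝ :=
  Matrix.of fun u v => (if u = v then 1 else 0) - G.w u v / (√(G.deg u) * √(G.deg v))

theorem laplacian_isHermitian : G.laplacian.IsHermitian := by
  ext u v
  simp only [laplacian, Matrix.conjTranspose_apply, Matrix.of_apply, star_trivial, G.symm v u,
    eq_comm (a := v) (b := u), mul_comm (√(G.deg v))]

/-- The `i`-th smallest eigenvalue `λ_i` of the normalised Laplacian, for `1 ≤ i ≤ n`, counted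
with multiplicity (and `0` for other `i`).  Mathlib's `eigenvalues₀` is in decreasing order. -/
def lam (i : ℕ) : ℝ :=
  if h : 1 ≤ i ∧ i ≤ Fintype.card V then
    G.laplacian_isHermitian.eigenvalues₀ ⟨Fintype.card V - i, by omega⟩
  else 0

/-- `Υ(k) = λ_{k+1} / ρ(k)`, which is `∞` if `ρ(k) = 0 < λ_{k+1}`
(and `0` in the degenerate case `0 / 0`). -/
def gap (k : ℕ) : ℝ≥0∞ := ENNReal.ofReal (G.lam (k + 1)) / ENNReal.ofReal (G.rho k)

/-! ### The distributed algorithm -/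

/-- Seeding: the probability that node `v` becomes active. -/
def activeProb (sbar : ℝ≥0) (v : V) : ℝ := min 1 (sbar * G.deg v / G.totalVol)

open Classical in
/-- The probability, over independent choices of the nodes to become active, that the set `A`
of active nodes satisfies `E`. -/
def seedingProb (sbar : ℝ≥0) (E : Finset V → Prop) : ℝ :=
  ∑ A : Finset V with E A,
    (∏ v ∈ A, G.activeProb sbar v) * ∏ v ∈ Aᶜ, (1 - G.activeProb sbar v)

/-- Averaging: one round, in which every node combines its own value with those of its
neighbours.  This is the map `x ↦ (I - ℒ / 2) x`. -/
def average (x : V → ℝ) (v : V) : ℝ :=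
  1 / 2 * x v + 1 / 2 * ∑ u, G.w u v / (√(G.deg u) * √(G.deg v)) * x u

/-- The vector `x^{(t,i)}` of the active node `i` after `t` rounds, started from `χ_i`, the vector
with entry `1 / √d_i` at `i` and `0` elsewhere. -/
def state (t : ℕ) (i : V) : V → ℝ := G.average^[t] (Pi.single i (1 / √(G.deg i)))

open Classical in
/-- The active nodes whose vector has reached the node `v` after `t` rounds. -/
def reached (A : Finset V) (t : ℕ) (v : V) : Finset V := A.filter (fun i => G.state t i v ≠ 0)

open Classical in
/-- The number of words sent in `T` rounds of averaging: in round `t + 1` each node `u` sends to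
each of its neighbours, for every active node `i` whose vector has reached `u`, the two words
`i` and `x^{(t,i)}(u) / √d_u`. -/
def messageWords (A : Finset V) (T : ℕ) : ℕ :=
  ∑ t ∈ Finset.range T, ∑ u, ∑ _v : V with G.graph.Adj u _v, 2 * (G.reached A t u).card

end WeightedGraph

namespace WeightedGraph

variable {V : Type*} [Fintype V] [LinearOrder V] (G : WeightedGraph V)

/-- The values held by the node `v` at the end of the averaging. -/
def localValues (A : Finset V) (T : ℕ) (v : V) : Multiset ℝ :=
  (G.reached A T v).val.map (fun i => G.state T i v)

open Classical in
/-- Query: the label of the node `v` is the least (in the order of the node identifiers) active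
node `i` that has reached `v` and whose value `x^{(T,i)}(v)` is at least the threshold.  The
threshold is a function `θ` of the degree of `v` and of the values held by `v`.
If there is no such `i`, the node receives no label (`⊤`). -/
def label (θ : ℝ → Multiset ℝ → ℝ) (A : Finset V) (T : ℕ) (v : V) : WithTop V :=
  ((G.reached A T v).filter
    (fun i => θ (G.deg v) (G.localValues A T v) ≤ G.state T i v)).min

open Classical in
/-- The nodes that are misclassified with respect to the clusters `S` and to the labels `σ i` of
the clusters. -/
def misclassified {k : ℕ} (S : V → Fin k) (σ : Fin k → V) (θ : ℝ → Multiset ℝ → ℝ)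
    (A : Finset V) (T : ℕ) : Finset V :=
  Finset.univ.filter (fun v => G.label θ A T v ≠ (σ (S v) : WithTop V))

end WeightedGraph

end

/-! Let $W=I-\mathcal L/2$ and let $P$ be the orthogonal projection onto the span of the vectors
$D^{1/2}1_{S_j}$. After $T$ rounds $W^T$ is close to $PW^TP$ in Frobenius norm
(`sum_sq_walkError_le`): eigenvectors with eigenvalue at least $\lambda_{k+1}$ are damped, and the
$k$ others nearly span the range of $P$ because $\sum_j\phi(S_j)/\lambda_{k+1}$ is small. The
$k\times k$ compression of $W^T$ is nearly diagonal, since $T\rho(k)\le 1/4$ leaves the walk little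
time to escape a cluster (`one_sub_le_clusterWalk`, `clusterWalk_off_diagonal_le`).

Hence, at a node $v\in S_j$ where the error is small, seeds in $S_j$ have value about
$\sqrt{d_v}/\operatorname{vol}(S_j)$ and all others at most a quarter of that. Half of the largest
value held separates the two kinds, so all such nodes of a seeded cluster choose the same seed
(`label_eq`).

Seeds are drawn with probability at most proportional to degree, so the expected volume spoilt by
the error is at most $64\,\bar s\operatorname{vol}(V)$ times the squared Frobenius error. A single
Markov inequality (`success_probability`) covers the number of seeds, the spoilt volume and the
clusters without a seed.

The rate $\frac1\beta\log\frac1\beta$ would hit every cluster, but the spoilt volume grows with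
$\bar s$, and the gap controls only $\log\frac1\beta$, not $\frac1\beta$. The rate is therefore
capped at $k\sqrt{\log n}$, which the gap does control because $k^4\log^2\frac1\beta+\log n\ge
k^2\sqrt{\log n}$. Under the cap some clusters may be missed, but their expected share of the volume
is at most $k/\bar s=O(1/\sqrt{\log n})$. -/

namespace WeightedGraph

/-! ### The lazy random walk and the spectrum of the Laplacian. -/

section Weights

variable {V : Type*} [Fintype V] {G : WeightedGraph V}

theorem sum_weight_mul_sq (hd : ∀ v, 0 < G.deg v) (x : V → ℝ) :
    ∑ u, ∑ v, G.w u v * (x u / √(G.deg u)) ^ 2 = ∑ u, x u ^ 2 := by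
  refine Finset.sum_congr rfl fun u _ => ?_
  rw [← Finset.sum_mul, div_pow, Real.sq_sqrt (hd u).le]
  change G.deg u * _ = _
  field_simp [(hd u).ne']

theorem sum_weight_swap (G : WeightedGraph V) (y : V → ℝ) :
    ∑ u, ∑ v, G.w u v * y v = ∑ u, ∑ v, G.w u v * y u := by
  rw [Finset.sum_comm]
  exact Finset.sum_congr rfl fun u _ => Finset.sum_congr rfl fun v _ => by rw [G.symm]

end Weights

section Walk

variable {V : Type*} [Fintype V] [DecidableEq V] (G : WeightedGraph V)

/-- The matrix `I - ℒ / 2` of the lazy random walk. -/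
noncomputable def walk : Matrix V V ℝ := 1 - (1 / 2 : ℝ) • G.laplacian

theorem walk_apply (u v : V) : G.walk u v =
    (if u = v then 1 / 2 else 0) + 1 / 2 * (G.w u v / (√(G.deg u) * √(G.deg v))) := by
  simp only [walk, laplacian, Matrix.sub_apply, Matrix.one_apply, Matrix.smul_apply,
    Matrix.of_apply, smul_eq_mul]
  split_ifs <;> ring

theorem average_eq_mulVec (x : V → ℝ) : G.average x = G.walk.mulVec x := by
  ext v
  simp only [average, Matrix.mulVec, dotProduct, walk_apply, add_mul, Finset.sum_add_distrib,
    ite_mul, zero_mul, Finset.sum_ite_eq, Finset.mem_univ, if_true, Finset.mul_sum]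
  congr 1
  refine Finset.sum_congr rfl fun u _ => ?_
  rw [G.symm v u, mul_comm (√(G.deg v))]
  ring

theorem state_eq (t : ℕ) (i v : V) : G.state t i v = (G.walk ^ t) v i / √(G.deg i) := by
  have h : ∀ (t : ℕ) (x : V → ℝ), G.average^[t] x = (G.walk ^ t).mulVec x := by
    intro t
    induction t with
    | zero => intro x; simp
    | succ t ih =>
      intro x
      rw [Function.iterate_succ', Function.comp, ih, average_eq_mulVec, Matrix.mulVec_mulVec,
        ← pow_succ']
  rw [state, h, Matrix.mulVec_single]
  simp [div_eq_mul_inv, mul_comm]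

theorem walk_pow_transpose (t : ℕ) : (G.walk ^ t).transpose = G.walk ^ t := by
  have h : G.walk.transpose = G.walk := by
    ext u v
    simp only [Matrix.transpose_apply, walk_apply, G.symm v u, mul_comm (√(G.deg v)),
      eq_comm (a := v)]
  rw [Matrix.transpose_pow, h]

theorem walk_pow_nonneg (t : ℕ) (u v : V) : 0 ≤ (G.walk ^ t) u v := by
  induction t generalizing u v with
  | zero => simp only [pow_zero, Matrix.one_apply]; split_ifs <;> norm_num
  | succ t ih =>
    rw [pow_succ, Matrix.mul_apply]
    refine Finset.sum_nonneg fun x _ => mul_nonneg (ih _ _) ?_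
    rw [walk_apply]
    have := div_nonneg (G.nonneg x v) (mul_nonneg (Real.sqrt_nonneg (G.deg x))
      (Real.sqrt_nonneg (G.deg v)))
    split_ifs <;> linarith

variable {G}

theorem walk_pow_mulVec_sqrt_deg (hd : ∀ v, 0 < G.deg v) (t : ℕ) :
    (G.walk ^ t).mulVec (fun v => √(G.deg v)) = fun v => √(G.deg v) := by
  induction t with
  | zero => simp
  | succ t ih =>
    rw [pow_succ, ← Matrix.mulVec_mulVec]
    have : G.walk.mulVec (fun v => √(G.deg v)) = fun v => √(G.deg v) := by
      rw [← average_eq_mulVec]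
      ext v
      have hv := Real.sqrt_pos.2 (hd v)
      have h1 : ∑ u, G.w u v / (√(G.deg u) * √(G.deg v)) * √(G.deg u) = √(G.deg v) := by
        have : ∀ u, G.w u v / (√(G.deg u) * √(G.deg v)) * √(G.deg u) =
            G.w v u / √(G.deg v) := by
          intro u
          have hu := Real.sqrt_pos.2 (hd u)
          rw [G.symm u v]
          field_simp
        rw [Finset.sum_congr rfl fun u _ => this u, ← Finset.sum_div]
        change G.deg v / _ = _
        rw [div_eq_iff hv.ne', Real.mul_self_sqrt (hd v).le]
      rw [average, h1]
      ring
    rw [this, ih]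

/-- The form is left unsymmetrised: for an indicator vector the summand vanishes unless `u` is
inside and `v` outside, so the cut appears without a factor 2. -/
theorem laplacian_quadratic_form (hd : ∀ v, 0 < G.deg v) (x : V → ℝ) :
    ∑ u, ∑ v, x u * G.laplacian u v * x v = ∑ u, ∑ v, G.w u v *
      ((x u / √(G.deg u)) ^ 2 - x u / √(G.deg u) * (x v / √(G.deg v))) := by
  have h1 : ∑ u, ∑ v, x u * G.laplacian u v * x v = ∑ u, x u ^ 2 -
      ∑ u, ∑ v, G.w u v * (x u / √(G.deg u) * (x v / √(G.deg v))) := by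
    rw [← Finset.sum_sub_distrib]
    refine Finset.sum_congr rfl fun u _ => ?_
    have : x u ^ 2 = ∑ v, if u = v then x u * x v else 0 := by simp [sq]
    rw [this, ← Finset.sum_sub_distrib]
    refine Finset.sum_congr rfl fun v _ => ?_
    simp only [laplacian, Matrix.of_apply]
    split_ifs <;> ring
  rw [h1, ← sum_weight_mul_sq hd, ← Finset.sum_sub_distrib]
  refine Finset.sum_congr rfl fun u _ => ?_
  rw [← Finset.sum_sub_distrib]
  exact Finset.sum_congr rfl fun v _ => by ring

theorem laplacian_quadratic_form_nonneg (hd : ∀ v, 0 < G.deg v) (x : V → ℝ) :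
    0 ≤ ∑ u, ∑ v, x u * G.laplacian u v * x v := by
  have h := G.sum_weight_swap (fun u => (x u / √(G.deg u)) ^ 2)
  have h2 : 0 ≤ ∑ u, ∑ v, G.w u v * (x u / √(G.deg u) - x v / √(G.deg v)) ^ 2 :=
    Finset.sum_nonneg fun u _ => Finset.sum_nonneg fun v _ =>
      mul_nonneg (G.nonneg _ _) (sq_nonneg _)
  rw [laplacian_quadratic_form hd]
  simp only [sub_sq, mul_add, mul_sub, Finset.sum_add_distrib, Finset.sum_sub_distrib] at *
  rw [h] at h2
  have h3 : ∑ u, ∑ v, G.w u v * (2 * (x u / √(G.deg u)) * (x v / √(G.deg v))) =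
      2 * ∑ u, ∑ v, G.w u v * (x u / √(G.deg u) * (x v / √(G.deg v))) := by
    simp only [Finset.mul_sum]
    exact Finset.sum_congr rfl fun u _ => Finset.sum_congr rfl fun v _ => by ring
  rw [h3] at h2
  linarith

/-- The defect is half of the edge sum of squares with a plus sign in place of the minus sign. -/
theorem laplacian_quadratic_form_le (hd : ∀ v, 0 < G.deg v) (x : V → ℝ) :
    ∑ u, ∑ v, x u * G.laplacian u v * x v ≤ 2 * ∑ u, x u ^ 2 := by
  have h := G.sum_weight_swap (fun u => (x u / √(G.deg u)) ^ 2)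
  have h2 : 0 ≤ ∑ u, ∑ v, G.w u v * (x u / √(G.deg u) + x v / √(G.deg v)) ^ 2 :=
    Finset.sum_nonneg fun u _ => Finset.sum_nonneg fun v _ =>
      mul_nonneg (G.nonneg _ _) (sq_nonneg _)
  rw [laplacian_quadratic_form hd, ← sum_weight_mul_sq hd]
  simp only [add_sq, mul_add, mul_sub, Finset.sum_add_distrib, Finset.sum_sub_distrib] at *
  rw [h] at h2
  have h3 : ∑ u, ∑ v, G.w u v * (2 * (x u / √(G.deg u)) * (x v / √(G.deg v))) =
      2 * ∑ u, ∑ v, G.w u v * (x u / √(G.deg u) * (x v / √(G.deg v))) := by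
    simp only [Finset.mul_sum]
    exact Finset.sum_congr rfl fun u _ => Finset.sum_congr rfl fun v _ => by ring
  rw [h3] at h2
  linarith

/-- An orthonormal eigenbasis of the normalised Laplacian, as the rows of an orthogonal matrix,
together with the eigenvalues and a set of `n - k` of them that are at least `λ_{k+1}`. -/
theorem exists_eigenbasis (hd : ∀ v, 0 < G.deg v) {k : ℕ} (hk : k < Fintype.card V) :
    ∃ (F : Matrix V V ℝ) (μ : V → ℝ) (H : Finset V), F * F.transpose = 1 ∧
      F.transpose * F = 1 ∧ G.laplacian = F.transpose * Matrix.diagonal μ * F ∧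
      (∀ a, 0 ≤ μ a) ∧ (∀ a, μ a ≤ 2) ∧ (∀ a ∈ H, G.lam (k + 1) ≤ μ a) ∧ Hᶜ.card = k := by
  classical
  set hL := G.laplacian_isHermitian
  set U : Matrix V V ℝ := hL.eigenvectorUnitary.1 with hU
  set μ := hL.eigenvalues with hμ
  have hUU : U.transpose * U = 1 := by
    have := Unitary.coe_star_mul_self hL.eigenvectorUnitary
    simpa [Matrix.star_eq_conjTranspose] using this
  have hUU' : U * U.transpose = 1 := mul_eq_one_comm.1 hUU
  have hspec : G.laplacian = U * Matrix.diagonal μ * U.transpose := by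
    have := hL.spectral_theorem
    rw [Unitary.conjStarAlgAut_apply] at this
    simpa [Matrix.star_eq_conjTranspose, Function.comp_def] using this
  have hdiag : Matrix.diagonal μ = U.transpose * G.laplacian * U := by
    rw [hspec]
    calc Matrix.diagonal μ = (U.transpose * U) * Matrix.diagonal μ * (U.transpose * U) := by
          rw [hUU]; simp
      _ = _ := by simp only [Matrix.mul_assoc]
  have hquad : ∀ a, μ a = ∑ u, ∑ v, U u a * G.laplacian u v * U v a := by
    intro a
    have := congrFun (congrFun hdiag a) a
    rw [Matrix.diagonal_apply_eq] at this
    rw [this, Matrix.mul_apply, Finset.sum_comm]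
    refine Finset.sum_congr rfl fun v _ => ?_
    rw [Matrix.mul_apply, Finset.sum_mul]
    rfl
  have hnorm : ∀ a, ∑ u, U u a ^ 2 = 1 := by
    intro a
    have := congrFun (congrFun hUU a) a
    simpa [Matrix.mul_apply, sq] using this
  let e : Fin (Fintype.card V) ≃ V := Fintype.equivOfCardEq (Fintype.card_fin _)
  -- The set is cut out by position in the decreasing order, not by value, so that exactly `k`
  -- indices remain outside even when eigenvalues coincide; $\lambda_{k+1}$ sits at position
  -- $n-(k+1)$, the last one kept.
  refine ⟨U.transpose, μ, Finset.univ.filter fun a => (e.symm a : ℕ) < Fintype.card V - k,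
    by simpa using hUU, by simpa using hUU', by simpa using hspec, fun a => ?_, fun a => ?_,
    fun a ha => ?_, ?_⟩
  · rw [hquad]; exact laplacian_quadratic_form_nonneg hd _
  · rw [hquad]
    have := laplacian_quadratic_form_le hd (fun u => U u a)
    rw [hnorm] at this
    linarith
  · have ha' := (Finset.mem_filter.1 ha).2
    rw [lam, dif_pos ⟨by omega, by omega⟩]
    change _ ≤ hL.eigenvalues₀ (e.symm a)
    apply hL.eigenvalues₀_antitone
    rw [Fin.le_def]
    change (e.symm a : ℕ) ≤ Fintype.card V - (k + 1)
    omega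
  · have h1 : (Finset.univ.filter fun a => (e.symm a : ℕ) < Fintype.card V - k).card =
        Fintype.card V - k := by
      have : (Finset.univ.filter fun a => (e.symm a : ℕ) < Fintype.card V - k) =
          (Finset.univ.filter fun a : Fin (Fintype.card V) =>
            (a : ℕ) < Fintype.card V - k).map e.toEmbedding := by
        ext a; simp
      rw [this, Finset.card_map, Fin.card_filter_val_lt]
      omega
    rw [Finset.card_compl, h1]
    omega

end Walk

end WeightedGraph

/-! ### Averaging the walk over the clusters, and the Frobenius error. -/

theorem Matrix.sum_sq_eq_trace {m n : Type*} [Fintype m] [Fintype n] (X : Matrix m n ℝ) :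
    ∑ u, ∑ v, X u v ^ 2 = (X * X.transpose).trace := by
  simp [Matrix.trace, Matrix.mul_apply, sq]

/-- Compressing a symmetric matrix by an orthogonal projection on both sides changes it by at most
`√2` times as much, in Frobenius norm, as on one side. -/
theorem Matrix.sum_sq_sub_compression_le {m : Type*} [Fintype m] [DecidableEq m]
    (M P : Matrix m m ℝ) (hM : M.transpose = M) (hP : P.transpose = P) (hPP : P * P = P) :
    ∑ u, ∑ v, (M - P * M * P) u v ^ 2 ≤ 2 * ((M * M).trace - (M * M * P).trace) := by
  -- This is exactly the difference of the two sides of the claim, as the traces `e1` and `e2` show.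
  have h0 : 0 ≤ ∑ u, ∑ v, ((1 - P) * M * (1 - P)) u v ^ 2 :=
    Finset.sum_nonneg fun u _ => Finset.sum_nonneg fun v _ => sq_nonneg _
  rw [Matrix.sum_sq_eq_trace] at *
  have h1 : (M - P * M * P).transpose = M - P * M * P := by
    simp [Matrix.transpose_mul, hM, hP, Matrix.mul_assoc]
  have h2 : ((1 - P) * M * (1 - P)).transpose = (1 - P) * M * (1 - P) := by
    simp [Matrix.transpose_mul, hM, hP, Matrix.mul_assoc]
  have hQ : (1 - P) * (1 - P) = 1 - P := by
    simp [mul_sub, sub_mul, hPP]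
  have e1 : ((M - P * M * P) * (M - P * M * P)).trace =
      (M * M).trace - (M * P * M * P).trace := by
    have : (M - P * M * P) * (M - P * M * P) =
        M * M - M * P * M * P - P * M * P * M + P * (M * P * M * P) := by
      have : P * M * P * (P * M * P) = P * (M * P * M * P) := by
        calc P * M * P * (P * M * P) = P * M * (P * P) * (M * P) := by simp only [mul_assoc]
          _ = _ := by rw [hPP]; simp only [mul_assoc]
      rw [← this]; noncomm_ring
    rw [this, Matrix.trace_add, Matrix.trace_sub, Matrix.trace_sub,
      Matrix.trace_mul_comm P (M * P * M * P), show M * P * M * P * P = M * P * M * (P * P) by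
        simp only [mul_assoc], hPP, show P * M * P * M = P * (M * P * M) by simp only [mul_assoc],
      Matrix.trace_mul_comm P]
    ring
  have e2 : ((1 - P) * M * (1 - P) * ((1 - P) * M * (1 - P))).trace =
      (M * M).trace - 2 * (M * M * P).trace + (M * P * M * P).trace := by
    have : (1 - P) * M * (1 - P) * ((1 - P) * M * (1 - P)) =
        (1 - P) * (M * (1 - P) * M * (1 - P)) := by
      calc _ = (1 - P) * M * ((1 - P) * (1 - P)) * (M * (1 - P)) := by simp only [mul_assoc]
        _ = _ := by rw [hQ]; simp only [mul_assoc]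
    rw [this, Matrix.trace_mul_comm, mul_assoc, hQ]
    have : M * (1 - P) * M * (1 - P) = M * M - M * M * P - M * P * M + M * P * M * P := by
      noncomm_ring
    rw [this, Matrix.trace_add, Matrix.trace_sub, Matrix.trace_sub, mul_assoc M P M,
      Matrix.trace_mul_comm M (P * M), show P * M * M = P * (M * M) by simp only [mul_assoc],
      Matrix.trace_mul_comm P]
    ring
  rw [h1, e1]
  rw [h2, e2] at h0
  linarith

namespace WeightedGraph

section Clusters

variable {V : Type*} [Fintype V] (G : WeightedGraph V) {k : ℕ} (S : V → Fin k)

/-- The normalised vectors `D^{1/2} 1_{S_j}`, as the columns of a matrix. -/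
noncomputable def clusterBasis : Matrix V (Fin k) ℝ :=
  Matrix.of fun v j => if S v = j then √(G.deg v) / √(G.vol (cluster S j)) else 0

theorem clusterBasis_apply (v : V) (j : Fin k) : G.clusterBasis S v j =
    if S v = j then √(G.deg v) / √(G.vol (cluster S j)) else 0 := rfl

theorem sum_ite_cluster (f : V → ℝ) (j : Fin k) :
    ∑ v, (if S v = j then f v else 0) = ∑ v ∈ cluster S j, f v := by
  rw [cluster, Finset.sum_filter]

theorem vol_cluster_pos {G : WeightedGraph V} {S : V → Fin k} (hd : ∀ v, 0 < G.deg v) (hS : Function.Surjective S) (j : Fin k) :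
    0 < G.vol (cluster S j) := by
  obtain ⟨v, hv⟩ := hS j
  exact Finset.sum_pos (fun v _ => hd v) ⟨v, by simp [cluster, hv]⟩

theorem clusterBasis_transpose_mul_self {G : WeightedGraph V} {S : V → Fin k}
    (hd : ∀ v, 0 < G.deg v) (hS : Function.Surjective S) :
    (G.clusterBasis S).transpose * G.clusterBasis S = 1 := by
  ext j l
  rw [Matrix.mul_apply, Matrix.one_apply]
  simp only [Matrix.transpose_apply, clusterBasis_apply]
  split_ifs with h
  · subst h
    have hv := vol_cluster_pos hd hS j
    have : ∀ v, ((if S v = j then √(G.deg v) / √(G.vol (cluster S j)) else 0) *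
        if S v = j then √(G.deg v) / √(G.vol (cluster S j)) else 0) =
        if S v = j then G.deg v / G.vol (cluster S j) else 0 := by
      intro v
      split_ifs
      · rw [div_mul_div_comm, Real.mul_self_sqrt (hd v).le, Real.mul_self_sqrt hv.le]
      · simp
    rw [Finset.sum_congr rfl fun v _ => this v, sum_ite_cluster, ← Finset.sum_div]
    exact div_self hv.ne'
  · refine Finset.sum_eq_zero fun v _ => ?_
    split_ifs with h1 h2
    · exact absurd (h1.symm.trans h2) h
    all_goals simp

variable [DecidableEq V]

/-- The compression of `t` steps of the lazy random walk to the clusters. -/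
noncomputable def clusterWalk (t : ℕ) : Matrix (Fin k) (Fin k) ℝ :=
  (G.clusterBasis S).transpose * G.walk ^ t * G.clusterBasis S

/-- The difference between `t` steps of the lazy random walk and their average over clusters. -/
noncomputable def walkError (t : ℕ) : Matrix V V ℝ :=
  G.walk ^ t - G.clusterBasis S * (G.clusterBasis S).transpose * G.walk ^ t *
    (G.clusterBasis S * (G.clusterBasis S).transpose)

theorem walkError_apply (t : ℕ) (v i : V) : G.walkError S t v i = (G.walk ^ t) v i -
    √(G.deg v) / √(G.vol (cluster S (S v))) * G.clusterWalk S t (S v) (S i) *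
      (√(G.deg i) / √(G.vol (cluster S (S i)))) := by
  have : G.clusterBasis S * (G.clusterBasis S).transpose * G.walk ^ t *
      (G.clusterBasis S * (G.clusterBasis S).transpose) =
      G.clusterBasis S * G.clusterWalk S t * (G.clusterBasis S).transpose := by
    simp only [clusterWalk, Matrix.mul_assoc]
  rw [walkError, this, Matrix.sub_apply]
  congr 1
  simp [Matrix.mul_apply, clusterBasis_apply]

variable {G S}

theorem clusterBasis_quadratic_form (hd : ∀ v, 0 < G.deg v) (hS : Function.Surjective S)
    (j : Fin k) :
    ((G.clusterBasis S).transpose * G.laplacian * G.clusterBasis S) j j =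
      G.conductance (cluster S j) := by
  have hv := vol_cluster_pos hd hS j
  have h1 : ((G.clusterBasis S).transpose * G.laplacian * G.clusterBasis S) j j =
      ∑ u, ∑ v, G.clusterBasis S u j * G.laplacian u v * G.clusterBasis S v j := by
    rw [Matrix.mul_apply, Finset.sum_comm]
    refine Finset.sum_congr rfl fun v _ => ?_
    rw [Matrix.mul_apply, Finset.sum_mul]
    rfl
  have h2 : ∀ u, G.clusterBasis S u j / √(G.deg u) =
      if S u = j then 1 / √(G.vol (cluster S j)) else 0 := by
    intro u
    have := (Real.sqrt_pos.2 (hd u)).ne'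
    rw [clusterBasis_apply]
    split_ifs
    · field_simp
    · simp
  rw [h1, laplacian_quadratic_form hd, conductance, Finset.sum_div,
    ← sum_ite_cluster]
  simp only [h2]
  refine Finset.sum_congr rfl fun u _ => ?_
  split_ifs with hu
  · rw [Finset.sum_div, ← Finset.sum_subset (Finset.subset_univ (cluster S j)ᶜ)]
    · refine Finset.sum_congr rfl fun v hv' => ?_
      have : S v ≠ j := by simpa [cluster] using hv'
      rw [if_neg this, div_pow, Real.sq_sqrt hv.le]
      ring
    · intro v _ hv'
      have : S v = j := by simpa [cluster] using hv'
      rw [if_pos this]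
      ring
  · simp

theorem conductance_nonneg (hd : ∀ v, 0 < G.deg v) (A : Finset V) : 0 ≤ G.conductance A :=
  div_nonneg (Finset.sum_nonneg fun u _ => Finset.sum_nonneg fun v _ => G.nonneg u v)
    (Finset.sum_nonneg fun v _ => (hd v).le)

theorem walk_pow_eq_of_spectral {F : Matrix V V ℝ} {μ : V → ℝ} (hF' : F * F.transpose = 1)
    (hF : F.transpose * F = 1)
    (hL : G.laplacian = F.transpose * Matrix.diagonal μ * F) (t : ℕ) :
    G.walk ^ t = F.transpose * Matrix.diagonal (fun a => (1 - μ a / 2) ^ t) * F := by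
  induction t with
  | zero => simp [hF]
  | succ t ih =>
    have hw : G.walk = F.transpose * Matrix.diagonal (fun a => 1 - μ a / 2) * F := by
      have : Matrix.diagonal (fun a => 1 - μ a / 2) = 1 - (1 / 2 : ℝ) • Matrix.diagonal μ := by
        ext a b
        by_cases h : a = b
        · subst h; simp; ring
        · simp [h]
      rw [walk, hL, this, mul_sub, sub_mul]
      simp [hF]
    calc G.walk ^ (t + 1) = F.transpose * Matrix.diagonal (fun a => (1 - μ a / 2) ^ t) *
          (F * F.transpose) * Matrix.diagonal (fun a => 1 - μ a / 2) * F := by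
          rw [pow_succ, ih, hw]; simp only [Matrix.mul_assoc]
      _ = F.transpose * (Matrix.diagonal (fun a => (1 - μ a / 2) ^ t) *
          Matrix.diagonal (fun a => 1 - μ a / 2)) * F := by
          rw [hF']; simp only [Matrix.mul_assoc, Matrix.one_mul]
      _ = _ := by simp only [Matrix.diagonal_mul_diagonal, pow_succ]

theorem transpose_mul_diagonal_mul_apply {m n : Type*} [Fintype m] [DecidableEq m]
    (c : Matrix m n ℝ) (f : m → ℝ) (j : n) :
    (c.transpose * Matrix.diagonal f * c) j j = ∑ a, f a * c a j ^ 2 := by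
  rw [Matrix.mul_apply]
  refine Finset.sum_congr rfl fun a _ => ?_
  rw [Matrix.mul_diagonal, Matrix.transpose_apply]
  ring

theorem sum_mul_sq_clusterBasis (hd : ∀ v, 0 < G.deg v) (hS : Function.Surjective S)
    {F : Matrix V V ℝ} {μ : V → ℝ} (hL : G.laplacian = F.transpose * Matrix.diagonal μ * F)
    (j : Fin k) :
    ∑ a, μ a * (F * G.clusterBasis S) a j ^ 2 = G.conductance (cluster S j) := by
  rw [← transpose_mul_diagonal_mul_apply, ← clusterBasis_quadratic_form hd hS, hL]
  simp only [Matrix.transpose_mul, Matrix.mul_assoc]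

theorem transpose_mul_self_mul_clusterBasis (hd : ∀ v, 0 < G.deg v) (hS : Function.Surjective S)
    {F : Matrix V V ℝ} (hF : F.transpose * F = 1) :
    (F * G.clusterBasis S).transpose * (F * G.clusterBasis S) = 1 := by
  rw [Matrix.transpose_mul, Matrix.mul_assoc, ← Matrix.mul_assoc F.transpose, hF,
    Matrix.one_mul, clusterBasis_transpose_mul_self hd hS]

theorem sum_sq_clusterBasis (hd : ∀ v, 0 < G.deg v) (hS : Function.Surjective S)
    {F : Matrix V V ℝ} (hF : F.transpose * F = 1) (j : Fin k) :
    ∑ a, (F * G.clusterBasis S) a j ^ 2 = 1 := by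
  have := congrFun (congrFun (transpose_mul_self_mul_clusterBasis hd hS hF) j) j
  rw [Matrix.mul_apply, Matrix.one_apply_eq] at this
  simpa [sq] using this

/-- Bessel's inequality: with $c=FB$, the matrix $cc^{\mathsf T}$ is an orthogonal projection, so a
diagonal entry $p$ satisfies $p^2\le p$. -/
theorem sum_sq_row_clusterBasis_le (hd : ∀ v, 0 < G.deg v) (hS : Function.Surjective S)
    {F : Matrix V V ℝ} (hF : F.transpose * F = 1) (a : V) :
    ∑ j, (F * G.clusterBasis S) a j ^ 2 ≤ 1 := by
  have h1 := transpose_mul_self_mul_clusterBasis hd hS hF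
  generalize F * G.clusterBasis S = c at h1
  have h2 : (c * c.transpose) a a = ∑ j, c a j ^ 2 := by simp [Matrix.mul_apply, sq]
  have h3 : (c * c.transpose) * (c * c.transpose).transpose = c * c.transpose := by
    rw [Matrix.transpose_mul, Matrix.transpose_transpose, Matrix.mul_assoc,
      ← Matrix.mul_assoc c.transpose, h1, Matrix.one_mul]
  have h4 : ∑ b, (c * c.transpose) a b ^ 2 = (c * c.transpose) a a := by
    conv_rhs => rw [← h3]
    rw [Matrix.mul_apply]
    simp [sq]
  have h5 := Finset.single_le_sum (f := fun b => (c * c.transpose) a b ^ 2)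
    (fun b _ => sq_nonneg _) (Finset.mem_univ a)
  simp only [h4] at h5
  rw [← h2]
  nlinarith

/-- The Frobenius distance between the lazy random walk and its average over clusters. -/
theorem sum_sq_walkError_le (hd : ∀ v, 0 < G.deg v) (hS : Function.Surjective S)
    (hk : k < Fintype.card V) (hlam : 0 < G.lam (k + 1)) (t : ℕ) :
    ∑ u, ∑ v, G.walkError S t u v ^ 2 ≤
      2 * ((∑ j, G.conductance (cluster S j)) / G.lam (k + 1) +
        Fintype.card V * Real.exp (-(G.lam (k + 1) * t))) := by
  obtain ⟨F, μ, H, hF', hF, hL, hμ0, hμ2, hH, hcard⟩ := exists_eigenbasis hd hk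
  set B := G.clusterBasis S with hB
  set c := F * B with hc
  set lam := G.lam (k + 1) with hlamdef
  set m : V → ℝ := fun a => ((1 - μ a / 2) ^ t) ^ 2 with hm
  have hW := walk_pow_eq_of_spectral hF' hF hL t
  have hBB := clusterBasis_transpose_mul_self hd hS
  have hWW : G.walk ^ t * G.walk ^ t = F.transpose * Matrix.diagonal m * F := by
    calc G.walk ^ t * G.walk ^ t = F.transpose * Matrix.diagonal (fun a => (1 - μ a / 2) ^ t) *
          (F * F.transpose) * Matrix.diagonal (fun a => (1 - μ a / 2) ^ t) * F := by
          rw [hW]; simp only [Matrix.mul_assoc]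
      _ = F.transpose * (Matrix.diagonal (fun a => (1 - μ a / 2) ^ t) *
          Matrix.diagonal (fun a => (1 - μ a / 2) ^ t)) * F := by
          rw [hF']; simp only [Matrix.mul_assoc, Matrix.one_mul]
      _ = _ := by simp only [Matrix.diagonal_mul_diagonal, hm, sq]
  have htr1 : (G.walk ^ t * G.walk ^ t).trace = ∑ a, m a := by
    rw [hWW, Matrix.trace_mul_comm, ← Matrix.mul_assoc, hF', Matrix.one_mul,
      Matrix.trace_diagonal]
  have htr2 : (G.walk ^ t * G.walk ^ t * (B * B.transpose)).trace =
      ∑ a, m a * ∑ j, c a j ^ 2 := by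
    have : (c * c.transpose * Matrix.diagonal m).trace = ∑ a, m a * ∑ j, c a j ^ 2 := by
      rw [Matrix.trace]
      refine Finset.sum_congr rfl fun a _ => ?_
      rw [Matrix.diag_apply, Matrix.mul_diagonal, mul_comm, Matrix.mul_apply]
      simp [sq]
    rw [← this, hWW, hc, Matrix.transpose_mul]
    rw [show F.transpose * Matrix.diagonal m * F * (B * B.transpose) =
      (F.transpose * Matrix.diagonal m) * (F * (B * B.transpose)) by simp only [Matrix.mul_assoc],
      Matrix.trace_mul_comm]
    simp only [Matrix.mul_assoc]
  have hcomp := Matrix.sum_sq_sub_compression_le (G.walk ^ t) (B * B.transpose)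
    (G.walk_pow_transpose t) (by simp [Matrix.transpose_mul])
    (by rw [Matrix.mul_assoc, ← Matrix.mul_assoc B.transpose, hBB, Matrix.one_mul])
  rw [htr1, htr2, ← Finset.sum_sub_distrib] at hcomp
  refine hcomp.trans (mul_le_mul_of_nonneg_left ?_ (by norm_num))
  have hbes : ∀ a, ∑ j, c a j ^ 2 ≤ 1 := sum_sq_row_clusterBasis_le hd hS hF
  have hbes0 : ∀ a, 0 ≤ ∑ j, c a j ^ 2 := fun a => Finset.sum_nonneg fun j _ => sq_nonneg _
  have habs : ∀ a, |1 - μ a / 2| ≤ 1 := fun a =>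
    abs_le.2 ⟨by linarith [hμ2 a], by linarith [hμ0 a]⟩
  have hm0 : ∀ a, 0 ≤ m a := fun a => sq_nonneg _
  have hm1 : ∀ a, m a ≤ 1 := fun a => by
    simp only [hm]
    rw [← sq_abs, abs_pow]
    exact pow_le_one₀ (by positivity) (pow_le_one₀ (abs_nonneg _) (habs a))
  have hmH : ∀ a ∈ H, m a ≤ Real.exp (-(lam * t)) := by
    intro a ha
    have h1 : |1 - μ a / 2| ≤ Real.exp (-(lam / 2)) := by
      have := Real.add_one_le_exp (-(lam / 2))
      rw [abs_of_nonneg (by linarith [hμ2 a])]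
      linarith [hH a ha]
    simp only [hm]
    rw [← sq_abs, abs_pow]
    calc (|1 - μ a / 2| ^ t) ^ 2 ≤ (Real.exp (-(lam / 2)) ^ t) ^ 2 := by gcongr
      _ = Real.exp (-(lam * t)) := by
        rw [← Real.exp_nat_mul, ← Real.exp_nat_mul]
        congr 1
        push_cast
        ring
  rw [← Finset.sum_compl_add_sum H]
  refine add_le_add ?_ ?_
  · have h1 : ∑ a ∈ Hᶜ, (m a - m a * ∑ j, c a j ^ 2) ≤ ∑ a ∈ Hᶜ, (1 - ∑ j, c a j ^ 2) := by
      refine Finset.sum_le_sum fun a _ => ?_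
      nlinarith [hm1 a, hbes a]
    refine h1.trans ?_
    -- There are as many low eigenvectors as clusters, so the mass missing from the low part equals
    -- the mass that the cluster vectors put on the high part.
    have h2 : ∑ a ∈ Hᶜ, (1 - ∑ j, c a j ^ 2) = ∑ j, ∑ a ∈ H, c a j ^ 2 := by
      rw [Finset.sum_sub_distrib, Finset.sum_const, hcard, Finset.sum_comm]
      have : ∀ j, ∑ a ∈ H, c a j ^ 2 = 1 - ∑ a ∈ Hᶜ, c a j ^ 2 := by
        intro j
        rw [← sum_sq_clusterBasis hd hS hF j, ← Finset.sum_compl_add_sum H]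
        ring
      rw [Finset.sum_congr rfl fun j _ => this j, Finset.sum_sub_distrib]
      simp
    rw [h2, Finset.sum_div]
    refine Finset.sum_le_sum fun j _ => ?_
    -- Each unit of mass on `H` costs at least $\lambda_{k+1}$ in the quadratic form, whose value is
    -- the conductance.
    rw [le_div_iff₀ hlam, Finset.sum_mul, ← sum_mul_sq_clusterBasis hd hS hL j]
    refine (Finset.sum_le_sum fun a ha => ?_).trans
      (Finset.sum_le_sum_of_subset_of_nonneg (Finset.subset_univ H) fun a _ _ =>
        mul_nonneg (hμ0 a) (sq_nonneg _))
    rw [mul_comm]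
    exact mul_le_mul_of_nonneg_right (hH a ha) (sq_nonneg _)
  · calc ∑ a ∈ H, (m a - m a * ∑ j, c a j ^ 2) ≤ ∑ a ∈ H, Real.exp (-(lam * t)) := by
          refine Finset.sum_le_sum fun a ha => ?_
          nlinarith [hm0 a, hbes0 a, hmH a ha]
      _ = H.card * Real.exp (-(lam * t)) := by simp
      _ ≤ _ := by
        gcongr
        exact Finset.card_le_univ H

/-- Bernoulli's inequality for each eigenvalue, averaged with the squared coordinates of the cluster
vector as weights. -/
theorem one_sub_le_clusterWalk (hd : ∀ v, 0 < G.deg v) (hS : Function.Surjective S)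
    (hk : k < Fintype.card V) (t : ℕ) (j : Fin k) :
    1 - t * G.conductance (cluster S j) / 2 ≤ G.clusterWalk S t j j := by
  obtain ⟨F, μ, H, hF', hF, hL, hμ0, hμ2, -, -⟩ := exists_eigenbasis hd hk
  have h1 : G.clusterWalk S t j j =
      ∑ a, (1 - μ a / 2) ^ t * (F * G.clusterBasis S) a j ^ 2 := by
    rw [← transpose_mul_diagonal_mul_apply, clusterWalk, walk_pow_eq_of_spectral hF' hF hL]
    simp only [Matrix.transpose_mul, Matrix.mul_assoc]
  rw [h1]
  calc 1 - t * G.conductance (cluster S j) / 2 =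
        ∑ a, (1 + t * (-(μ a / 2))) * (F * G.clusterBasis S) a j ^ 2 := by
        rw [← sum_mul_sq_clusterBasis hd hS hL j]
        conv_lhs => rw [← sum_sq_clusterBasis hd hS hF j]
        rw [Finset.mul_sum, Finset.sum_div, ← Finset.sum_sub_distrib]
        exact Finset.sum_congr rfl fun a _ => by ring
    _ ≤ _ := by
        refine Finset.sum_le_sum fun a _ => mul_le_mul_of_nonneg_right ?_ (sq_nonneg _)
        have := one_add_mul_le_pow (a := -(μ a / 2)) (by linarith [hμ2 a]) t
        rwa [← sub_eq_add_neg] at this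

theorem clusterWalk_nonneg (t : ℕ) (j l : Fin k) : 0 ≤ G.clusterWalk S t j l := by
  have hB : ∀ v j, 0 ≤ G.clusterBasis S v j := fun v j => by
    rw [clusterBasis_apply]; split_ifs <;> positivity
  rw [clusterWalk, Matrix.mul_apply]
  refine Finset.sum_nonneg fun v _ => mul_nonneg ?_ (hB _ _)
  rw [Matrix.mul_apply]
  exact Finset.sum_nonneg fun u _ => mul_nonneg (hB _ _) (G.walk_pow_nonneg t _ _)

theorem clusterWalk_symm (t : ℕ) (j l : Fin k) :
    G.clusterWalk S t j l = G.clusterWalk S t l j := by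
  have : (G.clusterWalk S t).transpose = G.clusterWalk S t := by
    simp [clusterWalk, Matrix.transpose_mul, walk_pow_transpose, Matrix.mul_assoc,
      -Matrix.transpose_pow]
  exact congrFun (congrFun this l) j

/-- The stationary vector $D^{1/2}1$ is fixed by the walk and lies in the span of the cluster
vectors, so its coordinates are fixed by the compression. -/
theorem clusterWalk_mulVec (hd : ∀ v, 0 < G.deg v) (hS : Function.Surjective S) (t : ℕ)
    (j : Fin k) :
    ∑ l, G.clusterWalk S t j l * √(G.vol (cluster S l)) = √(G.vol (cluster S j)) := by
  have h1 : (G.clusterBasis S).mulVec (fun l => √(G.vol (cluster S l))) =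
      fun v => √(G.deg v) := by
    ext v
    have := (Real.sqrt_pos.2 (vol_cluster_pos hd hS (S v))).ne'
    simp only [Matrix.mulVec, dotProduct, clusterBasis_apply, ite_mul, zero_mul,
      Finset.sum_ite_eq, Finset.mem_univ, if_true]
    field_simp
  have h2 : (G.clusterBasis S).transpose.mulVec (fun v => √(G.deg v)) =
      fun l => √(G.vol (cluster S l)) := by
    rw [← h1, Matrix.mulVec_mulVec, clusterBasis_transpose_mul_self hd hS, Matrix.one_mulVec]
  have h3 : (G.clusterWalk S t).mulVec (fun l => √(G.vol (cluster S l))) =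
      fun l => √(G.vol (cluster S l)) := by
    rw [clusterWalk, ← Matrix.mulVec_mulVec, h1, ← Matrix.mulVec_mulVec,
      walk_pow_mulVec_sqrt_deg hd, h2]
  exact congrFun h3 j

theorem clusterWalk_self_le_one (hd : ∀ v, 0 < G.deg v) (hS : Function.Surjective S) (t : ℕ)
    (j : Fin k) : G.clusterWalk S t j j ≤ 1 := by
  have h := Finset.single_le_sum (f := fun l => G.clusterWalk S t j l * √(G.vol (cluster S l)))
    (fun l _ => mul_nonneg (clusterWalk_nonneg t j l) (Real.sqrt_nonneg _)) (Finset.mem_univ j)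
  rw [clusterWalk_mulVec hd hS] at h
  have := Real.sqrt_pos.2 (vol_cluster_pos hd hS j)
  exact le_of_mul_le_mul_right (by simpa using h) this

/-- Entries are nonnegative, so in the fixed-vector identity for row `l` one off-diagonal term is at
most what the diagonal term leaves over. -/
theorem clusterWalk_off_diagonal_le (hd : ∀ v, 0 < G.deg v) (hS : Function.Surjective S)
    (t : ℕ) {j l : Fin k} (hjl : j ≠ l) :
    G.clusterWalk S t j l * √(G.vol (cluster S j)) ≤
      (1 - G.clusterWalk S t l l) * √(G.vol (cluster S l)) := by
  rw [clusterWalk_symm]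
  have h := Finset.add_le_sum (f := fun j => G.clusterWalk S t l j * √(G.vol (cluster S j)))
    (fun j _ => mul_nonneg (clusterWalk_nonneg t l j) (Real.sqrt_nonneg _))
    (Finset.mem_univ j) (Finset.mem_univ l) hjl
  rw [clusterWalk_mulVec hd hS] at h
  linarith

end Clusters

end WeightedGraph

/-! ### Random seeding. -/

theorem Finset.sum_prod_mul_prod_compl {V R : Type*} [Fintype V] [DecidableEq V] [CommSemiring R]
    (f g : V → R) :
    ∑ A : Finset V, (∏ v ∈ A, f v) * ∏ v ∈ Aᶜ, g v = ∏ v, (f v + g v) := by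
  rw [Finset.prod_add, Finset.powerset_univ]
  rfl

namespace WeightedGraph

section Volumes

variable {V : Type*} [Fintype V] {G : WeightedGraph V} (s : ℝ≥0)

theorem totalVol_nonneg (hd : ∀ v, 0 < G.deg v) : 0 ≤ G.totalVol :=
  Finset.sum_nonneg fun v _ => (hd v).le

theorem activeProb_nonneg (hd : ∀ v, 0 < G.deg v) (v : V) : 0 ≤ G.activeProb s v :=
  le_min zero_le_one (div_nonneg (mul_nonneg s.2 (hd v).le) (totalVol_nonneg hd))

theorem activeProb_le (v : V) : G.activeProb s v ≤ s * G.deg v / G.totalVol := min_le_right _ _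

theorem vol_cluster_le_totalVol {k : ℕ} {S : V → Fin k} (hd : ∀ v, 0 < G.deg v)
    (j : Fin k) :
    G.vol (cluster S j) ≤ G.totalVol :=
  Finset.sum_le_sum_of_subset_of_nonneg (Finset.subset_univ _) fun v _ _ => (hd v).le

/-- The probability that a set contains no active node. -/
theorem prod_one_sub_activeProb_le (X : Finset V) :
    ∏ v ∈ X, (1 - G.activeProb s v) ≤ Real.exp (-(s * G.vol X / G.totalVol)) := by
  have : -(s * G.vol X / G.totalVol) = ∑ v ∈ X, -(s * G.deg v / G.totalVol) := by
    rw [vol, Finset.sum_neg_distrib, Finset.mul_sum, Finset.sum_div]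
  rw [this, Real.exp_sum]
  refine Finset.prod_le_prod (fun v _ => sub_nonneg.2 (min_le_left _ _)) fun v _ => ?_
  rw [activeProb]
  rcases le_total (1 : ℝ) (s * G.deg v / G.totalVol) with h | h
  · rw [min_eq_left h, sub_self]
    exact (Real.exp_pos _).le
  · rw [min_eq_right h]
    linarith [Real.add_one_le_exp (-(s * G.deg v / G.totalVol))]

end Volumes

section Seeding

variable {V : Type*} [Fintype V] [DecidableEq V] (G : WeightedGraph V) (s : ℝ≥0)

/-- The probability that `A` is the set of active nodes. -/
noncomputable def seedWeight (A : Finset V) : ℝ :=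
  (∏ v ∈ A, G.activeProb s v) * ∏ v ∈ Aᶜ, (1 - G.activeProb s v)

theorem sum_seedWeight : ∑ A, G.seedWeight s A = 1 := by
  simp [seedWeight, Finset.sum_prod_mul_prod_compl]

theorem sum_seedWeight_mul_mem (c : V → ℝ) :
    ∑ A, G.seedWeight s A * ∑ i ∈ A, c i = ∑ i, G.activeProb s i * c i := by
  have h : ∀ i, ∑ A, (if i ∈ A then G.seedWeight s A else 0) = G.activeProb s i := by
    intro i
    -- The indicator is absorbed by zeroing the inactive factor at `i`; the sum stays a product over
    -- nodes, in which every factor but that of `i` is 1.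
    have h1 : ∀ A : Finset V, (if i ∈ A then G.seedWeight s A else 0) =
        (∏ v ∈ A, G.activeProb s v) *
          ∏ v ∈ Aᶜ, if v = i then 0 else 1 - G.activeProb s v := by
      intro A
      split_ifs with hi
      · rw [seedWeight]
        congr 1
        refine Finset.prod_congr rfl fun v hv => ?_
        rw [if_neg]
        rintro rfl
        exact (Finset.mem_compl.1 hv) hi
      · rw [Finset.prod_eq_zero (i := i) (s := Aᶜ) (by simpa using hi) (by simp), mul_zero]
    rw [Finset.sum_congr rfl fun A _ => h1 A, Finset.sum_prod_mul_prod_compl,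
      Finset.prod_eq_single i]
    · simp
    · intro v _ hv; simp [hv]
    · simp
  simp_rw [← h, Finset.sum_mul, Finset.mul_sum]
  rw [Finset.sum_comm]
  refine Finset.sum_congr rfl fun A _ => ?_
  rw [← Finset.sum_subset (Finset.subset_univ A)]
  · exact Finset.sum_congr rfl fun i hi => by rw [if_pos hi]
  · intro i _ hi; simp [hi]

theorem sum_seedWeight_disjoint (X : Finset V) :
    ∑ A, (if Disjoint A X then G.seedWeight s A else 0) = ∏ v ∈ X, (1 - G.activeProb s v) := by
  have h1 : ∀ A : Finset V, (if Disjoint A X then G.seedWeight s A else 0) =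
      (∏ v ∈ A, if v ∈ X then 0 else G.activeProb s v) *
        ∏ v ∈ Aᶜ, (1 - G.activeProb s v) := by
    intro A
    split_ifs with hA
    · rw [seedWeight]
      congr 1
      exact Finset.prod_congr rfl fun v hv => (if_neg (Finset.disjoint_left.1 hA hv)).symm
    · obtain ⟨v, hv, hvX⟩ := Finset.not_disjoint_iff.1 hA
      rw [Finset.prod_eq_zero hv (by simp [hvX]), zero_mul]
  rw [Finset.sum_congr rfl fun A _ => h1 A, Finset.sum_prod_mul_prod_compl,
    ← Finset.prod_subset (Finset.subset_univ X)]
  · exact Finset.prod_congr rfl fun v hv => by simp [hv]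
  · intro v _ hv; simp [hv]

variable {G}

theorem seedWeight_nonneg (hd : ∀ v, 0 < G.deg v) (A : Finset V) : 0 ≤ G.seedWeight s A :=
  mul_nonneg (Finset.prod_nonneg fun v _ => activeProb_nonneg s hd v)
    (Finset.prod_nonneg fun _ _ => sub_nonneg.2 (min_le_left _ _))

theorem seedingProb_mono (hd : ∀ v, 0 < G.deg v) {E E' : Finset V → Prop}
    (h : ∀ A, E A → E' A) : G.seedingProb s E ≤ G.seedingProb s E' := by
  classical
  exact Finset.sum_le_sum_of_subset_of_nonneg
    (Finset.monotone_filter_right _ fun A _ hA => h A hA) fun A _ _ => seedWeight_nonneg s hd A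

/-- Markov's inequality. -/
theorem one_sub_le_seedingProb (hd : ∀ v, 0 < G.deg v) {E : Finset V → Prop} {f : Finset V → ℝ}
    (hf : ∀ A, 0 ≤ f A) (hE : ∀ A, f A < 1 → E A) :
    1 - ∑ A, G.seedWeight s A * f A ≤ G.seedingProb s E := by
  classical
  have h : G.seedingProb s E = ∑ A, if E A then G.seedWeight s A else 0 := by
    rw [seedingProb, Finset.sum_filter]
    exact Finset.sum_congr rfl fun A _ => by congr
  rw [h, ← G.sum_seedWeight s, ← Finset.sum_sub_distrib]
  refine Finset.sum_le_sum fun A _ => ?_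
  have hw := seedWeight_nonneg s hd A
  split_ifs with hA
  · nlinarith [mul_nonneg hw (hf A)]
  · have := not_lt.1 fun h => hA (hE A h)
    nlinarith

end Seeding

/-! ### Message complexity. -/

section Messages

variable {V : Type*} [Fintype V] [DecidableEq V] (G : WeightedGraph V)

/-- Every vector is counted as if it had reached every node: two words in each direction along each
edge. -/
theorem messageWords_le (A : Finset V) (T : ℕ) :
    G.messageWords A T ≤ T * (4 * G.numEdges * A.card) := by
  classical
  rw [messageWords]
  have hm : ∑ u, G.graph.degree u = 2 * G.numEdges := by
    rw [G.graph.sum_degrees_eq_twice_card_edges, numEdges, ← SimpleGraph.coe_edgeFinset,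
      Set.ncard_coe_finset]
  calc _ ≤ ∑ _t ∈ Finset.range T, ∑ u, G.graph.degree u * (2 * A.card) := by
        refine Finset.sum_le_sum fun t _ => Finset.sum_le_sum fun u _ => ?_
        rw [Finset.sum_const, smul_eq_mul]
        refine Nat.mul_le_mul ?_ (Nat.mul_le_mul_left 2 (Finset.card_le_card
          (Finset.filter_subset _ _)))
        rw [← SimpleGraph.card_neighborFinset_eq_degree, SimpleGraph.neighborFinset_eq_filter]
    _ = _ := by
        rw [← Finset.sum_mul, hm]
        simp only [Finset.sum_const, Finset.card_range, smul_eq_mul]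
        ring

end Messages

/-! ### The query step at a node with small error. -/

section Labels

variable {V : Type*} [Fintype V] [LinearOrder V] {G : WeightedGraph V} {k : ℕ} {S : V → Fin k}

/-- Half of the largest of the values held by a node. -/
noncomputable def halfMax (m : Multiset ℝ) : ℝ := ((m.map Real.toNNReal).sup : ℝ≥0) / 2

theorem halfMax_le {m : Multiset ℝ} {c : ℝ} (hc : 0 ≤ c) (h : ∀ x ∈ m, x ≤ c) :
    halfMax m ≤ c / 2 := by
  rw [halfMax]
  have : (m.map Real.toNNReal).sup ≤ c.toNNReal := by
    rw [Multiset.sup_le]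
    intro b hb
    obtain ⟨x, hx, rfl⟩ := Multiset.mem_map.1 hb
    exact Real.toNNReal_le_toNNReal (h x hx)
  have := (NNReal.coe_le_coe.2 this).trans_eq (Real.coe_toNNReal c hc)
  linarith

theorem le_halfMax {m : Multiset ℝ} {x : ℝ} (hx : x ∈ m) : x / 2 ≤ halfMax m := by
  rw [halfMax]
  have := NNReal.coe_le_coe.2 (Multiset.le_sup (Multiset.mem_map_of_mem Real.toNNReal hx))
  linarith [Real.le_coe_toNNReal x]

/-- A node at which all seeds have a small error gets as its label the least seed of its
cluster. -/
theorem label_eq (hd : ∀ v, 0 < G.deg v) (hS : Function.Surjective S)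
    (hk : k < Fintype.card V) {T : ℕ} (hT : ∀ j, T * G.conductance (cluster S j) ≤ 1 / 4)
    {A : Finset V} {v : V} (hseed : ¬ Disjoint A (cluster S (S v)))
    (herr : ∀ i ∈ A, G.walkError S T v i ^ 2 ≤ G.deg v * G.deg i / (8 * G.totalVol) ^ 2) :
    G.label (fun _ => halfMax) A T v = (A.filter fun i => S i = S v).min := by
  classical
  set j := S v with hj
  set vj := G.vol (cluster S j) with hvj
  have hvj0 : 0 < vj := vol_cluster_pos hd hS j
  have hvV : vj ≤ G.totalVol := vol_cluster_le_totalVol hd j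
  set a := √(G.deg v) / vj with ha
  have hdv := Real.sqrt_pos.2 (hd v)
  have ha0 : 0 < a := div_pos hdv hvj0
  have hdiag : ∀ l, 7 / 8 ≤ G.clusterWalk S T l l := fun l => by
    linarith [one_sub_le_clusterWalk hd hS hk T l, hT l]
  set mean : V → ℝ := fun i => √(G.deg v) / √vj * G.clusterWalk S T j (S i) /
    √(G.vol (cluster S (S i))) with hmean
  have hstate : ∀ i ∈ A, |G.state T i v - mean i| ≤ a / 8 := by
    intro i hi
    have hdi := Real.sqrt_pos.2 (hd i)
    have h1 : G.state T i v - mean i = G.walkError S T v i / √(G.deg i) := by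
      rw [walkError_apply, state_eq, hmean, ← hj, ← hvj]
      field_simp
    rw [h1, abs_div, abs_of_pos hdi, div_le_iff₀ hdi]
    -- The tolerance in `herr` uses the total volume; as the cluster volume is no larger, the
    -- resulting error is at most `a / 8`.
    have h2 : |G.walkError S T v i| ≤ √(G.deg v) * √(G.deg i) / (8 * G.totalVol) := by
      refine abs_le_of_sq_le_sq ?_ (div_nonneg (by positivity) (by linarith))
      rw [div_pow, mul_pow, Real.sq_sqrt (hd v).le, Real.sq_sqrt (hd i).le]
      exact herr i hi
    refine h2.trans ?_
    rw [ha, show √(G.deg v) / vj / 8 * √(G.deg i) = √(G.deg v) * √(G.deg i) / (8 * vj) by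
      field_simp]
    gcongr
  have hsq : √vj * √vj = vj := Real.mul_self_sqrt hvj0.le
  have hsq0 : 0 < √vj := Real.sqrt_pos.2 hvj0
  have ha' : a = √(G.deg v) / (√vj * √vj) := by rw [hsq]
  have hsame : ∀ i, S i = j → mean i = a * G.clusterWalk S T j j := by
    intro i hi
    simp only [hmean, hi]
    rw [← hvj, ha']
    field_simp
  have hother : ∀ i, S i ≠ j → mean i ≤ a / 8 := by
    intro i hi
    have h1 := clusterWalk_off_diagonal_le (G := G) hd hS T (Ne.symm hi)
    have hl0 := Real.sqrt_pos.2 (vol_cluster_pos hd hS (S i))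
    have h2 : G.clusterWalk S T j (S i) * √vj ≤ 1 / 8 * √(G.vol (cluster S (S i))) :=
      h1.trans (mul_le_mul_of_nonneg_right (by linarith [hdiag (S i)]) hl0.le)
    calc mean i = a * (G.clusterWalk S T j (S i) * √vj / √(G.vol (cluster S (S i)))) := by
          simp only [hmean]
          rw [ha']
          field_simp
      _ ≤ a * (1 / 8) := by
          refine mul_le_mul_of_nonneg_left ?_ ha0.le
          rwa [div_le_iff₀ hl0]
      _ = a / 8 := by ring
  have hsame_ge : ∀ i ∈ A, S i = j → 3 / 4 * a ≤ G.state T i v := by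
    intro i hi hij
    have := (abs_le.1 (hstate i hi)).1
    rw [hsame i hij] at this
    nlinarith [hdiag j]
  have hother_le : ∀ i ∈ A, S i ≠ j → G.state T i v ≤ 1 / 4 * a := by
    intro i hi hij
    linarith [(abs_le.1 (hstate i hi)).2, hother i hij]
  have hle : ∀ i ∈ A, G.state T i v ≤ 9 / 8 * a := by
    intro i hi
    by_cases hij : S i = j
    · have := (abs_le.1 (hstate i hi)).2
      rw [hsame i hij] at this
      nlinarith [clusterWalk_self_le_one (G := G) hd hS T j]
    · linarith [hother_le i hi hij]
  -- The threshold lies between `3 / 8 * a` and `9 / 16 * a`, hence strictly between the foreign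
  -- values (at most `a / 4`) and the own ones (at least `3 / 4 * a`).
  have hup : halfMax (G.localValues A T v) ≤ 9 / 8 * a / 2 := by
    refine halfMax_le (by positivity) fun x hx => ?_
    obtain ⟨i, hi, rfl⟩ := Multiset.mem_map.1 hx
    exact hle i (Finset.mem_filter.1 hi).1
  have hlow : 3 / 4 * a / 2 ≤ halfMax (G.localValues A T v) := by
    obtain ⟨i, hi, hi'⟩ := Finset.not_disjoint_iff.1 hseed
    have hij : S i = j := (Finset.mem_filter.1 hi').2
    have h1 := hsame_ge i hi hij
    have : G.state T i v ∈ G.localValues A T v :=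
      Multiset.mem_map_of_mem _ (Finset.mem_filter.2 ⟨hi, by linarith⟩)
    linarith [le_halfMax this]
  rw [label]
  congr 1
  ext i
  simp only [reached, Finset.mem_filter]
  constructor
  · rintro ⟨⟨hi, -⟩, h2⟩
    refine ⟨hi, by_contra fun hij => ?_⟩
    linarith [hother_le i hi hij]
  · rintro ⟨hi, hij⟩
    have h1 := hsame_ge i hi hij
    exact ⟨⟨hi, by linarith⟩, by linarith⟩

end Labels

end WeightedGraph

namespace WeightedGraph

/-! ### Misclassified volume and the probability of success. -/

section Success

variable {V : Type*} [Fintype V] {G : WeightedGraph V} {k : ℕ} {S : V → Fin k}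

theorem vol_mono (hd : ∀ v, 0 < G.deg v) {X Y : Finset V} (h : X ⊆ Y) : G.vol X ≤ G.vol Y :=
  Finset.sum_le_sum_of_subset_of_nonneg h fun v _ _ => (hd v).le

theorem sum_vol_cluster : ∑ j, G.vol (cluster S j) = G.totalVol := by
  simp only [vol, cluster, totalVol]
  exact Finset.sum_fiberwise _ _ _

variable [LinearOrder V]

theorem vol_union_le (hd : ∀ v, 0 < G.deg v) (X Y : Finset V) :
    G.vol (X ∪ Y) ≤ G.vol X + G.vol Y := by
  have h : G.vol (X ∪ Y) + G.vol (X ∩ Y) = G.vol X + G.vol Y := Finset.sum_union_inter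
  have : 0 ≤ G.vol (X ∩ Y) := Finset.sum_nonneg fun v _ => (hd v).le
  linarith

theorem vol_biUnion_le (hd : ∀ v, 0 < G.deg v) {ι : Type*} [DecidableEq ι] (I : Finset ι)
    (X : ι → Finset V) : G.vol (I.biUnion X) ≤ ∑ i ∈ I, G.vol (X i) := by
  induction I using Finset.induction_on with
  | empty => simp [vol]
  | insert i I hi ih =>
    rw [Finset.biUnion_insert, Finset.sum_insert hi]
    exact (vol_union_le hd _ _).trans (by linarith)

variable (G S) in
/-- The nodes at which the vector of `i` is far from its average over the clusters. -/
noncomputable def badNodes (T : ℕ) (i : V) : Finset V :=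
  Finset.univ.filter fun v => G.deg v * G.deg i / (8 * G.totalVol) ^ 2 < G.walkError S T v i ^ 2

/-- Chebyshev's inequality. The factor `G.deg i` matches the activation probability of `i`, so that
summing over `i` yields the Frobenius norm. -/
theorem deg_mul_vol_badNodes_le (hV : 0 < G.totalVol) (T : ℕ) (i : V) :
    G.deg i * G.vol (G.badNodes S T i) ≤
      64 * G.totalVol ^ 2 * ∑ v, G.walkError S T v i ^ 2 := by
  rw [vol, Finset.mul_sum, Finset.mul_sum]
  refine (Finset.sum_le_sum fun v hv => ?_).trans (Finset.sum_le_sum_of_subset_of_nonneg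
    (Finset.subset_univ (G.badNodes S T i)) fun v _ _ => by positivity)
  have h := (Finset.mem_filter.1 hv).2.le
  rw [div_le_iff₀ (by positivity)] at h
  linarith

/-- A seeded cluster is assigned its least seed, any other an arbitrary member; injectivity follows
because each label lies in its own cluster. -/
theorem exists_assignment (hd : ∀ v, 0 < G.deg v) (hS : Function.Surjective S)
    (hk : k < Fintype.card V) {T : ℕ} (hT : ∀ j, T * G.conductance (cluster S j) ≤ 1 / 4)
    (A : Finset V) :
    ∃ σ : Fin k → V, Function.Injective σ ∧
      G.vol (G.misclassified S σ (fun _ => halfMax) A T) ≤ ∑ i ∈ A, G.vol (G.badNodes S T i) +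
        ∑ j with Disjoint A (cluster S j), G.vol (cluster S j) := by
  have hσ : ∀ j, ∃ w, S w = j ∧
      (¬ Disjoint A (cluster S j) → (A.filter fun i => S i = j).min = (w : WithTop V)) := by
    intro j
    by_cases h : Disjoint A (cluster S j)
    · obtain ⟨w, hw⟩ := hS j
      exact ⟨w, hw, fun h' => absurd h h'⟩
    · obtain ⟨i, hi, hi'⟩ := Finset.not_disjoint_iff.1 h
      obtain ⟨w, hw⟩ := Finset.min_of_mem
        (Finset.mem_filter.2 ⟨hi, (Finset.mem_filter.1 hi').2⟩ : i ∈ A.filter fun i => S i = j)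
      exact ⟨w, (Finset.mem_filter.1 (Finset.mem_of_min hw)).2, fun _ => hw⟩
  choose σ hσ1 hσ2 using hσ
  refine ⟨σ, fun j l h => by rw [← hσ1 j, ← hσ1 l, h], ?_⟩
  have hsub : G.misclassified S σ (fun _ => halfMax) A T ⊆ A.biUnion (G.badNodes S T) ∪
      (Finset.univ.filter fun j => Disjoint A (cluster S j)).biUnion (cluster S) := by
    intro v hv
    by_contra hv'
    simp only [Finset.mem_union, Finset.mem_biUnion, not_or, not_exists, not_and] at hv'
    have hseed : ¬ Disjoint A (cluster S (S v)) := fun h =>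
      hv'.2 (S v) (by simpa using h) (by simp [cluster])
    have herr : ∀ i ∈ A, G.walkError S T v i ^ 2 ≤ G.deg v * G.deg i / (8 * G.totalVol) ^ 2 :=
      fun i hi => by simpa [badNodes] using hv'.1 i hi
    exact (Finset.mem_filter.1 hv).2
      ((label_eq hd hS hk hT hseed herr).trans (hσ2 _ hseed))
  refine (vol_mono hd hsub).trans ((vol_union_le hd _ _).trans ?_)
  exact add_le_add (vol_biUnion_le hd _ _) (vol_biUnion_le hd _ _)

/-- The algorithm succeeds if the random walk is close to its average over the clusters and if
every set of clusters without a seed is unlikely or small. -/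
theorem success_probability (hd : ∀ v, 0 < G.deg v) (hS : Function.Surjective S)
    (hk : k < Fintype.card V) {T : ℕ} (hT : ∀ j, T * G.conductance (cluster S j) ≤ 1 / 4)
    {s : ℝ≥0} (hs : 0 < s) {ε : ℝ} (hε : 0 < ε)
    (hF : s * ∑ u, ∑ v, G.walkError S T u v ^ 2 ≤ ε / 128000)
    {c : Fin k → ℝ} (hc : ∀ j, 0 ≤ c j)
    (hcvol : ∀ J : Finset (Fin k), ∑ j ∈ J, c j < 1 →
      ∑ j ∈ J, G.vol (cluster S j) ≤ ε / 2 * G.totalVol)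
    (hcsum : ∑ j, c j * Real.exp (-(s * G.vol (cluster S j) / G.totalVol)) ≤ 1 / 1000) :
    0.99 < G.seedingProb s (fun A =>
      (∃ σ : Fin k → V, Function.Injective σ ∧
        G.vol (G.misclassified S σ (fun _ => halfMax) A T) ≤ ε * G.totalVol) ∧
      (G.messageWords A T : ℝ) ≤ 4000 * (T * G.numEdges * s)) := by
  classical
  have hs' : (0 : ℝ) < s := hs
  obtain ⟨v₀⟩ : Nonempty V := Fintype.card_pos_iff.1 (by omega)
  have hV : 0 < G.totalVol := Finset.sum_pos (fun v _ => hd v) ⟨v₀, Finset.mem_univ _⟩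
  set b : V → ℝ := fun i => G.vol (G.badNodes S T i) with hb
  have hb0 : ∀ i, 0 ≤ b i := fun i => Finset.sum_nonneg fun v _ => (hd v).le
  set x : ℝ := 2 / (ε * G.totalVol) with hx
  have hx0 : 0 < x := by positivity
  set a : V → ℝ := fun i => 1 / (1000 * s) + x * b i with ha
  have ha0 : ∀ i, 0 ≤ a i := fun i => by have := hb0 i; positivity
  -- One cost for all failures: `f A < 1` bounds the number of seeds by `1000 * s`, the spoilt
  -- volume by half of the allowance, and, through `hcvol`, the unseeded volume by the other half.
  -- Each of the three parts has expectation at most 1/1000.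
  set f : Finset V → ℝ := fun A =>
    ∑ i ∈ A, a i + ∑ j, if Disjoint A (cluster S j) then c j else 0 with hf
  have hexp : ∑ A, G.seedWeight s A * f A ≤ 3 / 1000 := by
    have h1 : ∑ A, G.seedWeight s A * ∑ i ∈ A, a i ≤ 2 / 1000 := by
      rw [sum_seedWeight_mul_mem]
      calc ∑ i, G.activeProb s i * a i ≤ ∑ i, s * G.deg i / G.totalVol * a i :=
            Finset.sum_le_sum fun i _ => mul_le_mul_of_nonneg_right (activeProb_le s i) (ha0 i)
        _ = 1 / (1000 * G.totalVol) * ∑ i, G.deg i +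
            s / G.totalVol * x * ∑ i, G.deg i * b i := by
            rw [Finset.mul_sum, Finset.mul_sum, ← Finset.sum_add_distrib]
            refine Finset.sum_congr rfl fun i _ => ?_
            simp only [ha]
            field_simp
        _ ≤ 1 / 1000 + s / G.totalVol * x *
            ∑ i, 64 * G.totalVol ^ 2 * ∑ v, G.walkError S T v i ^ 2 := by
            refine add_le_add ?_ (mul_le_mul_of_nonneg_left
              (Finset.sum_le_sum fun i _ => deg_mul_vol_badNodes_le hV T i) (by positivity))
            change 1 / (1000 * G.totalVol) * G.totalVol ≤ _
            apply le_of_eq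
            field_simp
        _ = 1 / 1000 + 128 / ε * (s * ∑ u, ∑ v, G.walkError S T u v ^ 2) := by
            rw [← Finset.mul_sum, Finset.sum_comm, hx]
            field_simp
            ring
        _ ≤ 1 / 1000 + 128 / ε * (ε / 128000) := by gcongr
        _ = 2 / 1000 := by field_simp; norm_num
    have h2 : ∑ A, G.seedWeight s A * ∑ j, (if Disjoint A (cluster S j) then c j else 0) ≤
        1 / 1000 := by
      have : ∑ A, G.seedWeight s A * ∑ j, (if Disjoint A (cluster S j) then c j else 0) =
          ∑ j, c j * ∑ A, if Disjoint A (cluster S j) then G.seedWeight s A else 0 := by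
        simp_rw [Finset.mul_sum]
        rw [Finset.sum_comm]
        refine Finset.sum_congr rfl fun j _ => Finset.sum_congr rfl fun A _ => ?_
        split_ifs <;> ring
      rw [this]
      refine (Finset.sum_le_sum fun j _ => mul_le_mul_of_nonneg_left ?_ (hc j)).trans hcsum
      rw [sum_seedWeight_disjoint]
      exact prod_one_sub_activeProb_le s _
    simp only [hf, mul_add, Finset.sum_add_distrib]
    linarith
  refine lt_of_lt_of_le ?_ (one_sub_le_seedingProb s hd (f := f) (fun A => add_nonneg
    (Finset.sum_nonneg fun i _ => ha0 i)
    (Finset.sum_nonneg fun j _ => by split_ifs <;> simp [hc])) fun A hA => ?_)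
  · norm_num at hexp ⊢
    linarith
  have hA1 : ∑ i ∈ A, a i = A.card / (1000 * s) + x * ∑ i ∈ A, b i := by
    simp only [ha, Finset.sum_add_distrib, Finset.mul_sum, Finset.sum_const, nsmul_eq_mul]
    ring
  have hA2 : (∑ j, if Disjoint A (cluster S j) then c j else 0) =
      ∑ j with Disjoint A (cluster S j), c j := (Finset.sum_filter _ _).symm
  have hp1 : 0 ≤ A.card / (1000 * (s : ℝ)) := by positivity
  have hp2 : 0 ≤ x * ∑ i ∈ A, b i := mul_nonneg hx0.le (Finset.sum_nonneg fun i _ => hb0 i)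
  have hp3 : 0 ≤ ∑ j with Disjoint A (cluster S j), c j := Finset.sum_nonneg fun j _ => hc j
  simp only [hf, hA1, hA2] at hA
  constructor
  · obtain ⟨σ, hσ, hσ'⟩ := exists_assignment hd hS hk hT A
    refine ⟨σ, hσ, hσ'.trans ?_⟩
    have h1 : ∑ i ∈ A, b i ≤ ε / 2 * G.totalVol := by
      have : x * ∑ i ∈ A, b i ≤ 1 := by linarith
      rw [hx, div_mul_eq_mul_div, div_le_one (by positivity)] at this
      linarith
    have h2 := hcvol _ (show ∑ j with Disjoint A (cluster S j), c j < 1 by linarith)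
    linarith
  · have h1 : (A.card : ℝ) ≤ 1000 * s := by
      have : A.card / (1000 * (s : ℝ)) ≤ 1 := by linarith
      rwa [div_le_one (by positivity)] at this
    have h2 : (G.messageWords A T : ℝ) ≤ T * (4 * G.numEdges * A.card) := by
      exact_mod_cast G.messageWords_le A T
    calc (G.messageWords A T : ℝ) ≤ T * (4 * G.numEdges * A.card) := h2
      _ ≤ T * (4 * G.numEdges * (1000 * s)) := by gcongr
      _ = _ := by ring

theorem conductance_cluster_le_rho (hopt : G.IsOptimalClustering S) (j : Fin k) :
    G.conductance (cluster S j) ≤ G.rho k := by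
  rw [← hopt.2]
  exact le_ciSup (Set.finite_range fun j => G.conductance (cluster S j)).bddAbove j

/-- The real form of a lower bound on the gap. -/
theorem mul_rho_le_lam {z : ℝ} (hz : 0 < z) (h : ENNReal.ofReal z ≤ G.gap k) :
    0 < G.lam (k + 1) ∧ (0 ≤ G.rho k → z * G.rho k ≤ G.lam (k + 1)) := by
  rw [gap] at h
  have hlam : 0 < G.lam (k + 1) := by
    -- A zero numerator makes the quotient 0, also when the denominator is 0, so a positive lower
    -- bound excludes it.
    by_contra hl
    rw [ENNReal.ofReal_of_nonpos (not_lt.1 hl), ENNReal.zero_div, nonpos_iff_eq_zero,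
      ENNReal.ofReal_eq_zero] at h
    linarith
  refine ⟨hlam, fun hr => ?_⟩
  rcases hr.eq_or_lt with hr | hr
  · rw [← hr, mul_zero]
    exact hlam.le
  · rw [← ENNReal.ofReal_div_of_pos hr, ENNReal.ofReal_le_ofReal_iff (by positivity),
      le_div_iff₀ hr] at h
    exact h

end Success

end WeightedGraph

/-! ### Choice of the parameters and the main theorem. -/

open WeightedGraph in
theorem theorem2 :
    ∃ (sbar : ℕ → ℕ → ℝ → ℝ≥0) (θ : ℕ → ℕ → ℝ → ℝ → ℝ → Multiset ℝ → ℝ) (c₁ M : ℝ),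
      0 < c₁ ∧ 0 < M ∧
      ∀ c₂ ε : ℝ, 0 < ε → ∃ (C : ℝ) (N : ℕ), 0 < C ∧
        ∀ (V : Type*) [Fintype V] [LinearOrder V] (G : WeightedGraph V) (n k : ℕ) (β : ℝ)
          (S : V → Fin k) (T : ℕ),
          Fintype.card V = n → N ≤ n → k < n →
          (∀ v, 0 < G.deg v) →
          G.IsOptimalClustering S →
          0 < β → β ≤ 1 / 2 →
          (∀ i, β * G.totalVol ≤ G.vol (WeightedGraph.cluster S i)) →
          ENNReal.ofReal (C * ((k : ℝ) ^ 4 * Real.log (1 / β) ^ 2 + Real.log n)) ≤ G.gap k →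
          c₁ * (Real.log n / G.lam (k + 1)) ≤ T → T ≤ c₂ * (Real.log n / G.lam (k + 1)) →
          0.99 < G.seedingProb (sbar n k β) (fun A =>
            (∃ σ : Fin k → V, Function.Injective σ ∧
              G.vol (G.misclassified S σ (θ n k β G.totalVol) A T) ≤ ε * G.totalVol) ∧
            (G.messageWords A T : ℝ) ≤
              M * (T * G.numEdges * (1 / β * Real.log (1 / β)))) := by
  -- The exponent 11 serves $k\beta^{11}\le\beta^{10}\le2^{-10}$; $c_1=4$ gives
  -- $e^{-\lambda_{k+1}T}\le n^{-4}$; and $44000=4\cdot1000\cdot11$ combines words per edge, seeds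
  -- and rate.
  refine ⟨fun n k β => (11 * min (1 / β * Real.log (1 / β)) (k * √(Real.log n))).toNNReal,
    fun _ _ _ _ _ => halfMax, 4, 44000, by norm_num, by norm_num, fun c₂ ε hε => ?_⟩
  -- In `C`, the first term gives $T\rho(k)\le1/4$ and the second, with $5632000=11\cdot512000$,
  -- bounds the conductance part of the error. `N` ensures $\sqrt{\log n}\ge200/\varepsilon$ and
  -- $11/n\le\varepsilon/512000$.
  refine ⟨4 * |c₂| + 5632000 / ε, ⌈Real.exp ((200 / ε) ^ 2)⌉₊ + ⌈5632000 / ε⌉₊ + 2,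
    by positivity, ?_⟩
  intro V _ _ G n k β S T hn hN hkn hd hopt hβ hβ2 hvol hgap hT1 hT2
  have hk : k < Fintype.card V := hn ▸ hkn
  have hS := hopt.1
  obtain ⟨v₀⟩ : Nonempty V := Fintype.card_pos_iff.1 (by omega)
  have hk1 : (1 : ℝ) ≤ k := by
    have := (S v₀).2
    exact_mod_cast (by omega : 1 ≤ k)
  have hkn' : (k : ℝ) ≤ n := by exact_mod_cast hkn.le
  have hV : 0 < G.totalVol := Finset.sum_pos (fun v _ => hd v) ⟨v₀, Finset.mem_univ _⟩
  set C : ℝ := 4 * |c₂| + 5632000 / ε with hC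
  have hC1 : 4 * |c₂| ≤ C := le_add_of_nonneg_right (by positivity)
  have hC2 : 5632000 / ε ≤ C := le_add_of_nonneg_left (by positivity)
  have hC0 : 0 < C := lt_of_lt_of_le (by positivity) hC2
  have hN' : Real.exp ((200 / ε) ^ 2) + 5632000 / ε + 2 ≤ n := by
    have : ((⌈Real.exp ((200 / ε) ^ 2)⌉₊ + ⌈5632000 / ε⌉₊ + 2 : ℕ) : ℝ) ≤ n := by
      exact_mod_cast hN
    push_cast at this
    linarith [Nat.le_ceil (Real.exp ((200 / ε) ^ 2)), Nat.le_ceil (5632000 / ε)]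
  have he := Real.exp_pos ((200 / ε) ^ 2)
  have hε' : 0 < 5632000 / ε := by positivity
  have hn0 : (0 : ℝ) < n := by linarith
  set y := √(Real.log n) with hy
  have hlogn : (200 / ε) ^ 2 ≤ Real.log n := by
    rw [Real.le_log_iff_exp_le hn0]
    linarith
  have hlogn0 : 0 ≤ Real.log n := (sq_nonneg _).trans hlogn
  have hysq : y ^ 2 = Real.log n := Real.sq_sqrt hlogn0
  have hyε : 200 / ε ≤ y := Real.le_sqrt_of_sq_le hlogn
  have hy0 : 0 < y := lt_of_lt_of_le (by positivity) hyε
  have hyn : y ≤ n := by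
    refine Real.sqrt_le_iff.2 ⟨hn0.le, ?_⟩
    nlinarith [Real.log_le_self hn0.le]
  set l := Real.log (1 / β) with hl
  have hl1 : 1 / 2 ≤ l := by
    have h1 : Real.log 2 ≤ l := by
      refine Real.log_le_log (by norm_num) ?_
      rw [le_div_iff₀ hβ]
      linarith
    linarith [Real.log_two_gt_d9]
  set Z : ℝ := k ^ 4 * l ^ 2 + Real.log n with hZ
  -- Arithmetic–geometric mean, with `l ≥ 1 / 2`: $k^4/4+y^2\ge k^2y$.
  have hZ1 : k ^ 2 * y ≤ Z := by
    have h1 : (k : ℝ) ^ 4 * (1 / 4) ≤ k ^ 4 * l ^ 2 :=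
      mul_le_mul_of_nonneg_left (by nlinarith) (by positivity)
    rw [hZ, ← hysq]
    nlinarith [sq_nonneg ((k : ℝ) ^ 2 / 2 - y)]
  have hZ2 : Real.log n ≤ Z := le_add_of_nonneg_left (by positivity)
  have hZ0 : 0 < Z := lt_of_lt_of_le (by positivity) hZ1
  obtain ⟨hlam, hrho⟩ := mul_rho_le_lam (mul_pos hC0 hZ0) hgap
  have hφ0 : ∀ j, 0 ≤ G.conductance (cluster S j) := fun j => conductance_nonneg hd _
  have hφ : ∀ j, G.conductance (cluster S j) ≤ G.rho k := conductance_cluster_le_rho hopt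
  have hρ0 : 0 ≤ G.rho k := (hφ0 (S v₀)).trans (hφ _)
  have hρ := hrho hρ0
  set lam := G.lam (k + 1) with hlamdef
  set ρ := G.rho k with hρdef
  have hTφ : ∀ j, T * G.conductance (cluster S j) ≤ 1 / 4 := by
    intro j
    have h1 : T * lam ≤ |c₂| * Real.log n := by
      have : T * lam ≤ c₂ * (Real.log n / lam) * lam := mul_le_mul_of_nonneg_right hT2 hlam.le
      rw [show c₂ * (Real.log n / lam) * lam = c₂ * Real.log n by field_simp] at this
      exact this.trans (mul_le_mul_of_nonneg_right (le_abs_self _) hlogn0)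
    have h2 : (T * ρ) * (4 * lam) ≤ 1 * lam := by
      calc (T * ρ) * (4 * lam) = 4 * ρ * (T * lam) := by ring
        _ ≤ 4 * ρ * (|c₂| * Real.log n) := by gcongr
        _ = (4 * |c₂|) * Real.log n * ρ := by ring
        _ ≤ C * Z * ρ := by gcongr
        _ ≤ 1 * lam := by rw [one_mul]; exact hρ
    have h3 : (T * ρ) * 4 ≤ 1 := le_of_mul_le_mul_right (by linarith) hlam
    have h4 : T * G.conductance (cluster S j) ≤ T * ρ :=
      mul_le_mul_of_nonneg_left (hφ j) (Nat.cast_nonneg T)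
    linarith
  set r : ℝ := 11 * min (1 / β * l) (k * y) with hr
  have hr0 : 0 < r := mul_pos (by norm_num) (lt_min (by positivity) (by positivity))
  have hr1 : r ≤ 11 * (1 / β * l) := mul_le_mul_of_nonneg_left (min_le_left _ _) (by norm_num)
  have hr2 : r ≤ 11 * (k * y) := mul_le_mul_of_nonneg_left (min_le_right _ _) (by norm_num)
  have hcoe : (r.toNNReal : ℝ) = r := Real.coe_toNNReal r hr0.le
  have hF : (r.toNNReal : ℝ) * ∑ u, ∑ v, G.walkError S T u v ^ 2 ≤ ε / 128000 := by
    rw [hcoe]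
    have h1 := sum_sq_walkError_le hd hS hk hlam T
    have h2 : r * ((∑ j, G.conductance (cluster S j)) / lam) ≤ ε / 512000 := by
      have h3 : ∑ j, G.conductance (cluster S j) ≤ k * ρ := by
        simpa using Finset.sum_le_card_nsmul Finset.univ _ ρ fun j _ => hφ j
      rw [← mul_div_assoc, div_le_iff₀ hlam]
      calc r * ∑ j, G.conductance (cluster S j) ≤ 11 * (k * y) * (k * ρ) :=
          mul_le_mul hr2 h3 (Finset.sum_nonneg fun j _ => hφ0 j) (by positivity)
        _ = 11 * ρ * (k ^ 2 * y) := by ring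
        _ ≤ 11 * ρ * Z := by gcongr
        _ = ε / 512000 * (5632000 / ε * Z * ρ) := by field_simp; ring
        _ ≤ ε / 512000 * (C * Z * ρ) := by gcongr
        _ ≤ ε / 512000 * lam := by gcongr
    have h4 : r * (Fintype.card V * Real.exp (-(lam * T))) ≤ ε / 512000 := by
      -- The fourth power absorbs the crude bound `r ≤ 11 * (n * n)` and the factor `n`, leaving `11
      -- / n`.
      have h5 : Real.exp (-(lam * T)) ≤ 1 / n ^ 4 := by
        have : 4 * Real.log n ≤ lam * T := by
          have := mul_le_mul_of_nonneg_left hT1 hlam.le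
          rwa [show lam * (4 * (Real.log n / lam)) = 4 * Real.log n by field_simp] at this
        calc Real.exp (-(lam * T)) ≤ Real.exp (-(4 * Real.log n)) :=
              Real.exp_le_exp.2 (neg_le_neg this)
          _ = 1 / n ^ 4 := by
            rw [Real.exp_neg, show 4 * Real.log n = ((4 : ℕ) : ℝ) * Real.log n by norm_num,
              Real.exp_nat_mul, Real.exp_log hn0, one_div]
      rw [hn]
      calc r * (n * Real.exp (-(lam * T))) ≤ 11 * (n * n) * (n * (1 / n ^ 4)) := by
            refine mul_le_mul (hr2.trans ?_) ?_ (by positivity) (by positivity)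
            · gcongr
            · gcongr
        _ = 11 / n := by field_simp
        _ ≤ 11 / (5632000 / ε) := by
          refine div_le_div_of_nonneg_left (by norm_num) hε' ?_
          linarith
        _ = ε / 512000 := by field_simp; norm_num
    calc r * ∑ u, ∑ v, G.walkError S T u v ^ 2
        ≤ r * (2 * ((∑ j, G.conductance (cluster S j)) / lam +
          Fintype.card V * Real.exp (-(lam * T)))) := by gcongr
      _ = 2 * (r * ((∑ j, G.conductance (cluster S j)) / lam) +
          r * (Fintype.card V * Real.exp (-(lam * T)))) := by ring
      _ ≤ 2 * (ε / 512000 + ε / 512000) := by gcongr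
      _ = ε / 128000 := by ring
  have hseeds : ∃ c : Fin k → ℝ, (∀ j, 0 ≤ c j) ∧ (∀ J : Finset (Fin k), ∑ j ∈ J, c j < 1 →
      ∑ j ∈ J, G.vol (cluster S j) ≤ ε / 2 * G.totalVol) ∧
      ∑ j, c j * Real.exp (-(r.toNNReal * G.vol (cluster S j) / G.totalVol)) ≤ 1 / 1000 := by
    rw [hcoe]
    rcases le_total (1 / β * l) (k * y) with hmin | hmin
    -- Below the cap, cost 1 for each cluster means that none may be missed.
    · refine ⟨fun _ => 1, fun _ => zero_le_one, fun J hJ => ?_, ?_⟩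
      · have : J = ∅ := by
          rw [← Finset.card_eq_zero]
          simp only [Finset.sum_const, nsmul_eq_mul, mul_one] at hJ
          exact Nat.lt_one_iff.1 (by exact_mod_cast hJ)
        rw [this, Finset.sum_empty]
        positivity
      · have hkβ : k * β ≤ 1 := by
          have h1 : ∑ _j : Fin k, β * G.totalVol ≤ ∑ j, G.vol (cluster S j) :=
            Finset.sum_le_sum fun j _ => hvol j
          rw [sum_vol_cluster, Finset.sum_const, Finset.card_univ, Fintype.card_fin,
            nsmul_eq_mul, ← mul_assoc] at h1
          exact le_of_mul_le_mul_right (by linarith) hV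
        have h2 : ∀ j, Real.exp (-(r * G.vol (cluster S j) / G.totalVol)) ≤ β ^ 11 := by
          intro j
          have h3 : 11 * l ≤ r * G.vol (cluster S j) / G.totalVol := by
            rw [le_div_iff₀ hV, hr, min_eq_left hmin]
            calc 11 * l * G.totalVol = 11 * (1 / β * l) * (β * G.totalVol) := by field_simp
              _ ≤ _ := mul_le_mul_of_nonneg_left (hvol j) (by positivity)
          calc _ ≤ Real.exp (-(11 * l)) := Real.exp_le_exp.2 (neg_le_neg h3)
            _ = β ^ 11 := by
              rw [hl, one_div, Real.log_inv, mul_neg, neg_neg,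
                show 11 * Real.log β = ((11 : ℕ) : ℝ) * Real.log β by norm_num,
                Real.exp_nat_mul, Real.exp_log hβ]
        calc _ ≤ ∑ _j : Fin k, β ^ 11 := Finset.sum_le_sum fun j _ => by
              rw [one_mul]; exact h2 j
          _ = (k * β) * β ^ 10 := by
              rw [Finset.sum_const, Finset.card_univ, Fintype.card_fin, nsmul_eq_mul]; ring
          _ ≤ 1 * (1 / 2) ^ 10 := by gcongr
          _ ≤ 1 / 1000 := by norm_num
    · have hr3 : r = 11 * (k * y) := by rw [hr, min_eq_right hmin]
      -- At the cap, the cost of a missed cluster is proportional to its volume; $pe^{-p}\le1$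
      -- bounds each expected cost independently of the cluster size.
      refine ⟨fun j => 2 / (ε * G.totalVol) * G.vol (cluster S j),
        fun j => mul_nonneg (by positivity) (vol_cluster_pos hd hS j).le, fun J hJ => ?_, ?_⟩
      · rw [← Finset.mul_sum, div_mul_eq_mul_div, div_lt_one (by positivity)] at hJ
        linarith
      · have h2 : ∀ j, 2 / (ε * G.totalVol) * G.vol (cluster S j) *
            Real.exp (-(r * G.vol (cluster S j) / G.totalVol)) ≤ 2 / (ε * r) := by
          intro j
          set p := r * G.vol (cluster S j) / G.totalVol with hp
          have h3 : p * Real.exp (-p) ≤ 1 := by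
            rw [Real.exp_neg, ← div_eq_mul_inv, div_le_one (Real.exp_pos _)]
            linarith [Real.add_one_le_exp p]
          calc _ = 2 / (ε * r) * (p * Real.exp (-p)) := by
                rw [hp]; field_simp
            _ ≤ 2 / (ε * r) * 1 := by gcongr
            _ = _ := mul_one _
        calc _ ≤ ∑ _j : Fin k, 2 / (ε * r) := Finset.sum_le_sum fun j _ => h2 j
          _ = 2 / (11 * (ε * y)) := by
              rw [Finset.sum_const, Finset.card_univ, Fintype.card_fin, nsmul_eq_mul, hr3]
              field_simp
          _ ≤ 2 / (11 * 200) := by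
              refine div_le_div_of_nonneg_left (by norm_num) (by norm_num) ?_
              rw [div_le_iff₀ hε] at hyε
              linarith
          _ ≤ 1 / 1000 := by norm_num
  obtain ⟨c, hc, hcvol, hcsum⟩ := hseeds
  have hmain := success_probability hd hS hk hTφ (s := r.toNNReal) (Real.toNNReal_pos.2 hr0)
    hε hF hc hcvol hcsum
  refine hmain.trans_le (seedingProb_mono _ hd fun A hA => ⟨hA.1, hA.2.trans ?_⟩)
  rw [hcoe]
  calc 4000 * (T * G.numEdges * r) ≤ 4000 * (T * G.numEdges * (11 * (1 / β * l))) := by gcongr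
    _ = _ := by ring
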